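/- Let $k$ be an algebraically closed field of characteristic $0$, let $n\ge 2$ be even, and put $m=n/2$. Regard $S_n$ as the group of permutations of $\mathbb Z/n$, let $a\in S_n$ be the $n$-cycle $i\mapsto i+1$, $F=C_n=\langle a\rangle$, and $G=S_{n-1}$ the subgroup fixing $n=0$. The factorization $S_n=FG$ gives a matched pair by $xb=(x\rhd b)(x\lhd b)$ with $x\rhd b\in F$, $x\lhd b\in G$ (for $x\in G$, $b\in F$). Let $J_n=k^{S_{n-1}}\#kC_n$ be the bismash product Hopf algebra of this matched pair, with basis $p_x\#b$ and $$(p_x\#b)(p_y\#c)=\delta_{y,\,x\lhd b}\;p_x\#bc,\qquad \Delta(p_x\#b)=\sum_{y\in G}(p_{xy^{-1}}\#(y\rhd b))\otimes(p_y\#b),\qquad \varepsilon(p_x\#b)=\delta_{x,1}.$$ For $x\in G$ let $F_x=\{b\in F: x\lhd b=x\}$, and let $M_{n/2}$ be the set of $x\in S_{n-1}$ with $F_x=\langle a^2\rangle$. For a character $\chi:F_x\to k^\times$ (with one-dimensional module $V_\chi$) let $\hat V_{x,\chi}=kF\otimes_{kF_x}V_\chi$ be the induced $J_n$-module, with action $(p_y\#b)\cdot(c\otimes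 v)=\delta_{y\lhd(bc),\,x}\,(bc\otimes v)$. The indicator of a finite-dimensional representation of $J_n$ with character $\psi$ is $\nu(\psi)=\psi\left(\sum\Lambda_1\Lambda_2\right)$, where $\Lambda$ is the two-sided integral with $\varepsilon(\Lambda)=1$. For $\epsilon\in\{+1,-1,0\}$ let $I_{n/2}^{(\epsilon)}$ be the number of $2$-dimensional irreducible representations of $J_n$ with indicator $\epsilon$, counted once for each permutation from which they are induced; that is, the number of pairs $(x,\chi)$, with $x\in S_{n-1}$ and $\chi$ a character of $F_x$, such that $\hat V_{x,\chi}$ is irreducible of dimension $2$ with indicator $\epsilon$. Put $$E_m=\{1\le j\le m: j^2\equiv1 \bmod m\},\qquad K_{j,m}=\{1\le u\le m: u(j+1)\equiv0 \bmod m\},$$ $$K'_{j,m}=\{1\le u\le m:(u+1)(j-1)\equiv0 \bmod m\},\qquad \alpha_{j,m}=\gcd(j+1,m),$$ and let $\overline\delta_{u,j,m}$ be $0$ if $j\equiv2u+1 \bmod m$ and $1$ otherwise; let $\delta^{0}_{i,u,m}$ be $1$ if $-i(u+1)\equiv0\bmod m$ and $0$ otherwise; and let $\delta^{\neq0}_{i,u,m}=1-\delta^0_{i,u,m}$.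 Then $$I_{n/2}^{(+1)}=\sum_{j\in E_m}\sum_{u\in K_{j,m}}\overline\delta_{u,j,m}\,\alpha_{j,m}+\sum_{j\in E_m}\sum_{u\in K'_{j,m}}\sum_{i\in K_{j,m}}\overline\delta_{u,j,m}\,\delta^0_{i,u,m},$$ $$I_{n/2}^{(-1)}=\sum_{j\in E_m}\sum_{u\in K'_{j,m}}\sum_{i\in K_{j,m}}\overline\delta_{u,j,m}\,\delta^{\neq0}_{i,u,m},$$ $$I_{n/2}^{(0)}=\frac n2\,|M_{n/2}|-I_{n/2}^{(+1)}-I_{n/2}^{(-1)}.$$ Moreover, there are only finitely many isomorphism classes of $2$-dimensional irreducible representations of $J_n$, each such representation has indicator $+1$, $-1$ or $0$, and for each value $c\in k$ the number of isomorphism classes with indicator $c$ is exactly half of the number of pairs $(x,\chi)$ as above for which $\hat V_{x,\chi}$ is irreducible of dimension $2$ with indicator $c$ (so the number with indicator $\epsilon$ is $\tfrac12 I_{n/2}^{(\epsilon)}$). -/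

import Mathlib

open scoped TensorProduct

noncomputable section

/-! ### Matched pairs of groups -/

/-- A matched pair of groups `(F, G, ▷, ◁)`: a right action `◁ : G × F → G` of `F` on the set `G`
and a left action `▷ : G × F → F` of `G` on the set `F` which are compatible. -/
structure MatchedPair (F G : Type*) [Group F] [Group G] where
  /-- `actF x a` is `x ▷ a`. -/
  actF : G → F → F
  /-- `actG x a` is `x ◁ a`. -/
  actG : G → F → G
  one_actF : ∀ a, actF 1 a = a
  mul_actF : ∀ x y a, actF (x * y) a = actF x (actF y a)
  actG_one : ∀ x, actG x 1 = x
  actG_mul : ∀ x a b, actG x (a * b) = actG (actG x a) b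
  actF_mul : ∀ x a b, actF x (a * b) = actF x a * actF (actG x a) b
  mul_actG : ∀ x y a, actG (x * y) a = actG x (actF y a) * actG y a

namespace MatchedPair

section

variable {F G : Type*} [Group F] [Group G] (M : MatchedPair F G)

theorem actF_one (x : G) : M.actF x 1 = 1 := by
  have h := M.actF_mul x 1 1
  rw [mul_one, M.actG_one] at h
  exact left_eq_mul.mp h

theorem one_actG (a : F) : M.actG 1 a = 1 := by
  have h := M.mul_actG 1 1 a
  rw [mul_one, M.one_actF] at h
  exact left_eq_mul.mp h

theorem actG_mul_inv (x : G) (a : F) : M.actG (M.actG x a) a⁻¹ = x := by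
  rw [← M.actG_mul, mul_inv_cancel, M.actG_one]

theorem actG_inv_mul (x : G) (a : F) : M.actG (M.actG x a⁻¹) a = x := by
  rw [← M.actG_mul, inv_mul_cancel, M.actG_one]

theorem actG_injective (a : F) : Function.Injective fun x => M.actG x a := fun x y h => by
  have h' : M.actG x a = M.actG y a := h
  rw [← M.actG_mul_inv x a, h', M.actG_mul_inv]

/-- The permutation `x ↦ x ◁ a` of `G`. -/
def actGEquiv (a : F) : G ≃ G where
  toFun x := M.actG x a
  invFun x := M.actG x a⁻¹
  left_inv x := M.actG_mul_inv x a
  right_inv x := M.actG_inv_mul x a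

/-- The stabilizer `F_x = {a ∈ F | x ◁ a = x}`. -/
def stab (x : G) : Subgroup F where
  carrier := {a | M.actG x a = x}
  one_mem' := M.actG_one x
  mul_mem' {a b} ha hb := by
    change M.actG x (a * b) = x
    rw [M.actG_mul, show M.actG x a = x from ha, show M.actG x b = x from hb]
  inv_mem' {a} ha := by
    change M.actG x a⁻¹ = x
    have h := M.actG_mul_inv x a
    rwa [show M.actG x a = x from ha] at h

end

/-- The matched pair of a factorizable group `L = FG`, `F ∩ G = 1`: the actions are determined by
`x * b = (x ▷ b) * (x ◁ b)` with `x ▷ b ∈ F` and `x ◁ b ∈ G`. -/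
def ofComplement {L : Type*} [Group L] {F G : Subgroup L}
    (h : Subgroup.IsComplement (F : Set L) (G : Set L)) : MatchedPair F G :=
  have key : ∀ (l : L) (b : F) (y : G), (b : L) * y = l →
      (h.equiv l).1 = b ∧ (h.equiv l).2 = y := fun l b y hl => by
    have : h.equiv l = (b, y) := by
      rw [← hl]
      exact h.equiv.apply_symm_apply (b, y)
    rw [this]
    exact ⟨rfl, rfl⟩
  have spec : ∀ (x : G) (b : F), ((h.equiv (x * b)).1 : L) * (h.equiv (x * b)).2 = x * b :=
    fun x b => h.equiv_fst_mul_equiv_snd _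
  { actF := fun x b => (h.equiv (x * b)).1
    actG := fun x b => (h.equiv (x * b)).2
    one_actF := fun a => (key _ a 1 (by simp)).1
    mul_actF := fun x y a => (key _ _
      ((h.equiv (x * ((h.equiv (y * a)).1 : L))).2 * (h.equiv ((y : L) * a)).2) (by
        have h1 := spec x (h.equiv (y * a)).1
        have h2 := spec y a
        push_cast
        rw [← mul_assoc, h1, mul_assoc, h2, mul_assoc])).1
    actG_one := fun x => (key _ 1 x (by simp)).2
    actG_mul := fun x a b => (key _
      ((h.equiv (x * a)).1 * (h.equiv (((h.equiv ((x : L) * a)).2 : L) * b)).1) _ (by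
        have h1 := spec (h.equiv (x * a)).2 b
        have h2 := spec x a
        push_cast
        rw [mul_assoc, h1, ← mul_assoc, h2, mul_assoc])).2
    actF_mul := fun x a b => (key _
      ((h.equiv (x * a)).1 * (h.equiv (((h.equiv ((x : L) * a)).2 : L) * b)).1)
      (h.equiv (((h.equiv ((x : L) * a)).2 : L) * b)).2 (by
        have h1 := spec (h.equiv (x * a)).2 b
        have h2 := spec x a
        push_cast
        rw [mul_assoc, h1, ← mul_assoc, h2, mul_assoc])).1
    mul_actG := fun x y a => (key _ (h.equiv (x * ((h.equiv (y * a)).1 : L))).1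
      ((h.equiv (x * ((h.equiv (y * a)).1 : L))).2 * (h.equiv ((y : L) * a)).2) (by
        have h1 := spec x (h.equiv (y * a)).1
        have h2 := spec y a
        push_cast
        rw [← mul_assoc, h1, mul_assoc, h2, mul_assoc])).2 }

end MatchedPair

/-! ### The bismash product Hopf algebra -/

/-- The vector space `k^G ⊗ kF` with basis `p_x # a`, for `x ∈ G` and `a ∈ F`, that underlies the
bismash product `k^G # kF` of a matched pair. -/
def Bismash (k : Type*) [Field k] {F G : Type*} [Group F] [Group G] (_M : MatchedPair F G) :=
  (G × F) →₀ k

namespace Bismash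

section

variable {k : Type*} [Field k] {F G : Type*} [Group F] [Group G] {M : MatchedPair F G}

instance : AddCommGroup (Bismash k M) := inferInstanceAs (AddCommGroup ((G × F) →₀ k))

instance : Module k (Bismash k M) := inferInstanceAs (Module k ((G × F) →₀ k))

variable (k M) in
/-- The basis `(x, a) ↦ p_x # a`. -/
def basis : Module.Basis (G × F) k (Bismash k M) := Finsupp.basisSingleOne

variable (k M) in
/-- The element `p_x # a`. -/
def elt (x : G) (a : F) : Bismash k M := basis k M (x, a)

theorem ext_elt {N : Type*} [AddCommMonoid N] [Module k N] {f g : Bismash k M →ₗ[k] N}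
    (h : ∀ x a, f (elt k M x a) = g (elt k M x a)) : f = g :=
  (basis k M).ext fun p => h p.1 p.2

variable (k M) in
open Classical in
/-- The multiplication `(p_x # a)(p_y # b) = δ_{y, x ◁ a} p_x # ab`. -/
def mulL : Bismash k M →ₗ[k] Bismash k M →ₗ[k] Bismash k M :=
  (basis k M).constr k fun p => (basis k M).constr k fun q =>
    if q.1 = M.actG p.1 p.2 then elt k M p.1 (p.2 * q.2) else 0

open Classical in
theorem mulL_elt (x y : G) (a b : F) :
    mulL k M (elt k M x a) (elt k M y b) = if y = M.actG x a then elt k M x (a * b) else 0 := by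
  simp [mulL, elt]

theorem mulL_assoc (u v w : Bismash k M) :
    mulL k M (mulL k M u v) w = mulL k M u (mulL k M v w) := by
  classical
  have h : (mulL k M).compr₂ (mulL k M) =
      (LinearMap.llcomp k (Bismash k M) (Bismash k M) (Bismash k M) ∘ₗ mulL k M).compl₂
        (mulL k M) := by
    refine ext_elt fun x a => ext_elt fun y b => ext_elt fun z c => ?_
    simp only [LinearMap.compr₂_apply, LinearMap.compl₂_apply, LinearMap.comp_apply,
      LinearMap.llcomp_apply, mulL_elt]
    by_cases h1 : y = M.actG x a
    · subst h1
      by_cases h2 : z = M.actG (M.actG x a) b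
      · subst h2
        simp [mulL_elt, M.actG_mul, mul_assoc]
      · simp [mulL_elt, M.actG_mul, h2]
    · by_cases h2 : z = M.actG y b
      · simp [mulL_elt, h1, h2]
      · simp [h1, h2]
  exact congrArg (fun f => f u v w) h

instance : Mul (Bismash k M) := ⟨fun u v => mulL k M u v⟩

open Classical in
theorem elt_mul_elt (x y : G) (a b : F) :
    elt k M x a * elt k M y b = if y = M.actG x a then elt k M x (a * b) else 0 :=
  mulL_elt x y a b

variable [Fintype G]

/-- The unit `1 # 1 = ∑_x p_x # 1`. -/
instance : One (Bismash k M) := ⟨∑ x : G, elt k M x 1⟩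

theorem one_def : (1 : Bismash k M) = ∑ x : G, elt k M x 1 := rfl

theorem one_mulL : mulL k M 1 = LinearMap.id := by
  classical
  refine ext_elt fun y b => ?_
  simp [one_def, mulL_elt, M.actG_one]

theorem mulL_one : (mulL k M).flip 1 = LinearMap.id := by
  classical
  refine ext_elt fun y b => ?_
  simp [one_def, mulL_elt]

instance : Ring (Bismash k M) :=
  { (inferInstance : AddCommGroup (Bismash k M)) with
    mul := fun u v => mulL k M u v
    one := 1
    left_distrib := fun u v w => (mulL k M u).map_add v w
    right_distrib := fun u v w => congrArg (fun f => f w) ((mulL k M).map_add u v)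
    zero_mul := fun u => congrArg (fun f => f u) (mulL k M).map_zero
    mul_zero := fun u => (mulL k M u).map_zero
    mul_assoc := mulL_assoc
    one_mul := fun u => congrArg (fun f => f u) one_mulL
    mul_one := fun u => congrArg (fun f => f u) mulL_one }

instance : Algebra k (Bismash k M) :=
  Algebra.ofModule (fun r u v => congrArg (fun f => f v) ((mulL k M).map_smul r u))
    (fun r u v => (mulL k M u).map_smul r v)

open Classical in
/-- The comultiplication `Δ(p_x # a) = ∑_y (p_{xy⁻¹} # (y ▷ a)) ⊗ (p_y # a)` and the counit
`ε(p_x # a) = δ_{x,1}`. -/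
instance : CoalgebraStruct k (Bismash k M) where
  comul := (basis k M).constr k fun p =>
    ∑ y : G, elt k M (p.1 * y⁻¹) (M.actF y p.2) ⊗ₜ[k] elt k M y p.2
  counit := (basis k M).constr k fun p => if p.1 = 1 then 1 else 0

theorem comul_elt (x : G) (a : F) : Coalgebra.comul (R := k) (elt k M x a) =
    ∑ y : G, elt k M (x * y⁻¹) (M.actF y a) ⊗ₜ[k] elt k M y a := by
  simp [Coalgebra.comul, elt]

open Classical in
theorem counit_elt (x : G) (a : F) : Coalgebra.counit (R := k) (elt k M x a) =
    if x = 1 then 1 else 0 := by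
  simp [Coalgebra.counit, elt]

instance : Coalgebra k (Bismash k M) where
  coassoc := ext_elt fun x a => by
    simp only [LinearMap.comp_apply, comul_elt, map_sum, LinearMap.rTensor_tmul,
      LinearMap.lTensor_tmul, TensorProduct.sum_tmul, TensorProduct.tmul_sum,
      LinearEquiv.coe_coe, TensorProduct.assoc_tmul]
    rw [Finset.sum_comm]
    conv_rhs => rw [Finset.sum_comm]
    rw [Finset.sum_comm]
    refine Finset.sum_congr rfl fun z _ => ?_
    refine Fintype.sum_equiv (Equiv.mulRight z) _ _ fun y => ?_
    simp [M.mul_actF, mul_assoc]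
  rTensor_counit_comp_comul := ext_elt fun x a => by
    classical
    simp only [LinearMap.comp_apply, comul_elt, map_sum, LinearMap.rTensor_tmul, counit_elt]
    rw [Finset.sum_eq_single x]
    · simp
    · intro y _ hy
      rw [if_neg, TensorProduct.zero_tmul]
      intro h
      exact hy (mul_inv_eq_one.mp h).symm
    · simp
  lTensor_counit_comp_comul := ext_elt fun x a => by
    classical
    simp only [LinearMap.comp_apply, comul_elt, map_sum, LinearMap.lTensor_tmul, counit_elt]
    rw [Finset.sum_eq_single 1]
    · simp [M.one_actF]
    · intro y _ hy
      rw [if_neg hy, TensorProduct.tmul_zero]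
    · simp

instance : Bialgebra k (Bismash k M) where
  counit_one := by
    classical
    simp [one_def, counit_elt]
  mul_compr₂_counit := ext_elt fun x a => ext_elt fun y b => by
    classical
    simp only [LinearMap.compr₂_apply, LinearMap.mul_apply', LinearMap.compl₁₂_apply, counit_elt,
      elt_mul_elt]
    by_cases hx : x = 1
    · subst hx
      by_cases hy : y = 1 <;> simp [hy, M.one_actG, counit_elt]
    · by_cases hy : y = M.actG x a <;> simp [hx, hy, counit_elt]
  comul_one := by
    classical
    simp only [one_def, map_sum, comul_elt, M.actF_one, Algebra.TensorProduct.one_def,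
      TensorProduct.sum_tmul, TensorProduct.tmul_sum]
    rw [Finset.sum_comm]
    refine Finset.sum_congr rfl fun y _ => ?_
    exact Fintype.sum_equiv (Equiv.mulRight y⁻¹) _ _ fun x => by simp
  mul_compr₂_comul := ext_elt fun x a => ext_elt fun x' b => by
    classical
    simp only [LinearMap.compr₂_apply, LinearMap.mul_apply', LinearMap.compl₁₂_apply, comul_elt,
      elt_mul_elt, Finset.sum_mul_sum, Algebra.TensorProduct.tmul_mul_tmul]
    have hy : ∀ y : G, M.actG (x * y⁻¹) (M.actF y a) = M.actG x a * (M.actG y a)⁻¹ := fun y => by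
      rw [eq_mul_inv_iff_mul_eq, ← M.mul_actG, inv_mul_cancel_right]
    have hsum : ∀ y : G, (∑ y' : G,
        (if x' * y'⁻¹ = M.actG (x * y⁻¹) (M.actF y a) then
          elt k M (x * y⁻¹) (M.actF y a * M.actF y' b) else 0) ⊗ₜ[k]
        (if y' = M.actG y a then elt k M y (a * b) else 0)) =
        if x' = M.actG x a then
          elt k M (x * y⁻¹) (M.actF y (a * b)) ⊗ₜ[k] elt k M y (a * b) else 0 := fun y => by
      rw [Finset.sum_eq_single (M.actG y a)]
      · rw [hy, M.actF_mul]
        by_cases hx : x' = M.actG x a <;> simp [hx]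
      · intro y' _ h
        rw [if_neg h, TensorProduct.tmul_zero]
      · simp
    rw [Finset.sum_congr rfl fun y _ => hsum y]
    by_cases hx : x' = M.actG x a <;> simp [hx, comul_elt]

/-- The Hopf algebra structure, with antipode `S(p_x # a) = p_{(x ◁ a)⁻¹} # (x ▷ a)⁻¹`. -/
instance : HopfAlgebra k (Bismash k M) where
  antipode := (basis k M).constr k fun p => elt k M (M.actG p.1 p.2)⁻¹ (M.actF p.1 p.2)⁻¹
  mul_antipode_rTensor_comul := ext_elt fun x a => by
    classical
    have hS : ∀ x a, ((basis k M).constr k fun p : G × F =>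
        elt k M (M.actG p.1 p.2)⁻¹ (M.actF p.1 p.2)⁻¹) (elt k M x a) =
        elt k M (M.actG x a)⁻¹ (M.actF x a)⁻¹ := fun x a => by simp [elt]
    have hy : ∀ y : G, M.actG (x * y⁻¹) (M.actF y a) = M.actG x a * (M.actG y a)⁻¹ := fun y => by
      rw [eq_mul_inv_iff_mul_eq, ← M.mul_actG, inv_mul_cancel_right]
    have hF : ∀ y : G, M.actF (x * y⁻¹) (M.actF y a) = M.actF x a := fun y => by
      rw [← M.mul_actF, inv_mul_cancel_right]
    have hz : ∀ y : G, M.actG (M.actG y a * (M.actG x a)⁻¹) (M.actF x a)⁻¹ = y * x⁻¹ := fun y => by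
      have h : M.actG y a * (M.actG x a)⁻¹ = M.actG (y * x⁻¹) (M.actF x a) := by
        rw [mul_inv_eq_iff_eq_mul, ← M.mul_actG, inv_mul_cancel_right]
      rw [h, M.actG_mul_inv]
    simp only [LinearMap.comp_apply, comul_elt, map_sum, LinearMap.rTensor_tmul, hS,
      LinearMap.mul'_apply, elt_mul_elt, counit_elt, hy, hF, mul_inv_rev, inv_inv, hz]
    by_cases hx : x = 1
    · subst hx
      simp only [inv_one, mul_one, if_true, M.one_actG, M.one_actF, inv_mul_cancel, map_one,
        Algebra.linearMap_apply]
      exact Fintype.sum_equiv (M.actGEquiv a) _ _ fun y => rfl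
    · simp [hx]
  mul_antipode_lTensor_comul := ext_elt fun x a => by
    classical
    have hS : ∀ x a, ((basis k M).constr k fun p : G × F =>
        elt k M (M.actG p.1 p.2)⁻¹ (M.actF p.1 p.2)⁻¹) (elt k M x a) =
        elt k M (M.actG x a)⁻¹ (M.actF x a)⁻¹ := fun x a => by simp [elt]
    have hy : ∀ y : G, M.actG (x * y⁻¹) (M.actF y a) = M.actG x a * (M.actG y a)⁻¹ := fun y => by
      rw [eq_mul_inv_iff_mul_eq, ← M.mul_actG, inv_mul_cancel_right]
    simp only [LinearMap.comp_apply, comul_elt, map_sum, LinearMap.lTensor_tmul, hS,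
      LinearMap.mul'_apply, elt_mul_elt, counit_elt, hy]
    by_cases hx : x = 1
    · subst hx
      simp only [M.one_actG, one_mul, if_true, mul_inv_cancel, map_one, Algebra.linearMap_apply]
      exact Fintype.sum_equiv (Equiv.inv G) _ _ fun y => rfl
    · have h1 : M.actG x a ≠ 1 := fun h => hx (M.actG_injective a (by
        simpa [M.one_actG] using h))
      simp [hx, h1]

end

end Bismash

/-! ### Representations and the Frobenius–Schur indicator -/

section Representations

variable {k : Type*} [Field k]

/-- A representation `ρ` of the algebra `A` is irreducible if the space is nonzero and the only
invariant subspaces are `0` and the whole space. -/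
def IsIrrep {A : Type*} [Ring A] [Algebra k A] {V : Type*} [AddCommGroup V] [Module k V]
    (ρ : A →ₐ[k] Module.End k V) : Prop :=
  Nontrivial V ∧ ∀ W : Submodule k V, (∀ a, ∀ v ∈ W, ρ a v ∈ W) → W = ⊥ ∨ W = ⊤

variable (k) in
/-- Irreducible representations of `A` of dimension `d`, realized on the space `k^d`. -/
def Irrep (A : Type*) [Ring A] [Algebra k A] (d : ℕ) :=
  {ρ : A →ₐ[k] Module.End k (Fin d → k) // IsIrrep ρ}

/-- Isomorphism of irreducible representations. -/
instance Irrep.setoid (A : Type*) [Ring A] [Algebra k A] (d : ℕ) : Setoid (Irrep k A d) where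
  r ρ σ := ∃ e : (Fin d → k) ≃ₗ[k] (Fin d → k), ∀ a v, e (ρ.1 a v) = σ.1 a (e v)
  iseqv :=
    { refl := fun _ => ⟨LinearEquiv.refl k _, fun _ _ => rfl⟩
      symm := fun ⟨e, he⟩ => ⟨e.symm, fun a v => by
        rw [LinearEquiv.symm_apply_eq, he, LinearEquiv.apply_symm_apply]⟩
      trans := fun ⟨e, he⟩ ⟨f, hf⟩ => ⟨e.trans f, fun a v => by
        rw [LinearEquiv.trans_apply, LinearEquiv.trans_apply, he, hf]⟩ }

variable (k) in
/-- Isomorphism classes of irreducible representations of `A` of dimension `d`. -/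
abbrev IrrepClass (A : Type*) [Ring A] [Algebra k A] (d : ℕ) := Quotient (Irrep.setoid (k := k) A d)

variable (k) in
/-- `Λ` is the two-sided integral of the Hopf algebra `A` with `ε(Λ) = 1`. -/
def IsNormalizedIntegral {A : Type*} [Ring A] [HopfAlgebra k A] (Λ : A) : Prop :=
  (∀ a : A, a * Λ = Coalgebra.counit (R := k) a • Λ) ∧
  (∀ a : A, Λ * a = Coalgebra.counit (R := k) a • Λ) ∧
  Coalgebra.counit (R := k) Λ = 1

theorem IsNormalizedIntegral.unique {A : Type*} [Ring A] [HopfAlgebra k A] {Λ Λ' : A}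
    (h : IsNormalizedIntegral k Λ) (h' : IsNormalizedIntegral k Λ') : Λ = Λ' := by
  have h1 := h.1 Λ'
  rw [h'.2.1 Λ, h.2.2, h'.2.2, one_smul, one_smul] at h1
  exact h1.symm

/-- The (second) Frobenius–Schur indicator of the representation `ρ` with character `χ` of the Hopf
algebra `A` equals `c`: the normalized integral `Λ` exists and `χ(∑ Λ₁ Λ₂) = c`. -/
def HasIndicator {A : Type*} [Ring A] [HopfAlgebra k A] {V : Type*} [AddCommGroup V] [Module k V]
    (ρ : A →ₐ[k] Module.End k V) (c : k) : Prop :=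
  ∃ Λ : A, IsNormalizedIntegral k Λ ∧
    LinearMap.trace k V (ρ (LinearMap.mul' k A (Coalgebra.comul (R := k) Λ))) = c

theorem HasIndicator.unique {A : Type*} [Ring A] [HopfAlgebra k A] {V : Type*} [AddCommGroup V]
    [Module k V] {ρ : A →ₐ[k] Module.End k V} {c c' : k} (h : HasIndicator ρ c)
    (h' : HasIndicator ρ c') : c = c' := by
  obtain ⟨Λ, hΛ, rfl⟩ := h
  obtain ⟨Λ', hΛ', rfl⟩ := h'
  rw [hΛ.unique hΛ']

variable (k) in
/-- The number of isomorphism classes of `d`-dimensional irreducible representations of `A` with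
indicator `c`. -/
def numIrrepClasses (A : Type*) [Ring A] [HopfAlgebra k A] (d : ℕ) (c : k) : ℕ :=
  Set.ncard {C : IrrepClass k A d | ∃ ρ : Irrep k A d, Quotient.mk _ ρ = C ∧ HasIndicator ρ.1 c}

end Representations

/-! ### Induced modules of bismash products -/

namespace Bismash

section

variable {k : Type*} [Field k] {F G : Type*} [Group F] [Group G] {M : MatchedPair F G}

/-- The relations `bc ⊗ 1 = b ⊗ χ(c)`, for `b ∈ F` and `c ∈ F_x`, in `kF ⊗ k`. -/
def inducedRel (x : G) (χ : M.stab x →* kˣ) : Submodule k (F →₀ k) :=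
  Submodule.span k (Set.range fun p : F × M.stab x =>
    Finsupp.single (p.1 * p.2) 1 - Finsupp.single p.1 (χ p.2 : k))

/-- The space `kF ⊗_{kF_x} V` where `V` is the one-dimensional representation of `F_x` with
character `χ`, as the quotient of `kF ⊗ k = kF` by the relations `bc ⊗ 1 = b ⊗ χ(c)`. -/
abbrev Induced (x : G) (χ : M.stab x →* kˣ) := (F →₀ k) ⧸ inducedRel x χ

variable (k M) in
open Classical in
/-- The map `p_y # a ↦ (b ↦ δ_{y ◁ (ab), x} ab)`. -/
def preAct (x : G) : Bismash k M →ₗ[k] Module.End k (F →₀ k) :=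
  (basis k M).constr k fun p => Finsupp.basisSingleOne.constr k fun b =>
    if M.actG p.1 (p.2 * b) = x then Finsupp.single (p.2 * b) 1 else 0

open Classical in
theorem preAct_elt (x y : G) (a b : F) (r : k) :
    preAct k M x (elt k M y a) (Finsupp.single b r) =
      if M.actG y (a * b) = x then Finsupp.single (a * b) r else 0 := by
  have h : (Finsupp.single b r : F →₀ k) = r • Finsupp.basisSingleOne (R := k) b := by simp
  rw [h]
  simp only [preAct, elt, Module.Basis.constr_basis, map_smul]
  split_ifs <;> simp

variable [Fintype G]

variable (k M) in
/-- `preAct` as a homomorphism of algebras. -/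
def preRep (x : G) : Bismash k M →ₐ[k] Module.End k (F →₀ k) :=
  AlgHom.ofLinearMap (preAct k M x)
    (by
      classical
      refine Finsupp.lhom_ext fun b r => ?_
      rw [one_def, map_sum, LinearMap.sum_apply, Finset.sum_eq_single (M.actG x b⁻¹)]
      · simp [preAct_elt, M.actG_inv_mul]
      · intro y _ hy
        rw [preAct_elt, one_mul, if_neg]
        rintro rfl
        exact hy (M.actG_mul_inv y b).symm
      · simp)
    (fun u v => by
      classical
      have h : (LinearMap.mul k (Bismash k M)).compr₂ (preAct k M x) =
          (LinearMap.mul k (Module.End k (F →₀ k))).compl₁₂ (preAct k M x) (preAct k M x) := by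
        refine ext_elt fun y a => ext_elt fun z c => Finsupp.lhom_ext fun b r => ?_
        simp only [LinearMap.compr₂_apply, LinearMap.mul_apply', LinearMap.compl₁₂_apply,
          elt_mul_elt, Module.End.mul_apply, preAct_elt]
        by_cases hz : z = M.actG y a
        · subst hz
          have e : M.actG (M.actG y a) (c * b) = M.actG y (a * c * b) := by
            rw [← M.actG_mul, mul_assoc]
          by_cases hx : M.actG y (a * c * b) = x
          · simp [preAct_elt, e, hx, ← mul_assoc]
          · simp [preAct_elt, e, hx]
        · by_cases hx : M.actG z (c * b) = x
          · have hne : M.actG y (a * (c * b)) ≠ x := fun h => hz (by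
              apply M.actG_injective (c * b)
              change M.actG z (c * b) = M.actG (M.actG y a) (c * b)
              rw [hx, ← M.actG_mul, h])
            simp [preAct_elt, hz, hx, hne]
          · simp [hz, hx]
      exact congrArg (fun f => f u v) h)

theorem preRep_inducedRel (x : G) (χ : M.stab x →* kˣ) (u : Bismash k M) :
    inducedRel x χ ≤ (inducedRel x χ).comap (preRep k M x u) := by
  classical
  rw [inducedRel, Submodule.span_le]
  rintro _ ⟨⟨b, c⟩, rfl⟩
  let f : Bismash k M →ₗ[k] Induced x χ := (inducedRel x χ).mkQ ∘ₗ
    (preAct k M x).flip (Finsupp.single (b * (c : F)) 1 - Finsupp.single b (χ c : k))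
  have hf : f = 0 := by
    refine ext_elt fun y a => ?_
    simp only [f, LinearMap.comp_apply, map_sub, LinearMap.sub_apply, LinearMap.flip_apply,
      preAct_elt, LinearMap.zero_apply]
    have e : M.actG y (a * (b * c)) = x ↔ M.actG y (a * b) = x := by
      rw [← mul_assoc, M.actG_mul]
      have hc : M.actG x c = x := c.2
      constructor
      · intro h
        apply M.actG_injective c
        change M.actG (M.actG y (a * b)) c = M.actG x c
        rw [h, hc]
      · intro h
        rw [h, hc]
    by_cases h : M.actG y (a * b) = x
    · rw [if_pos (e.mpr h), if_pos h, ← LinearMap.map_sub, Submodule.mkQ_apply,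
        Submodule.Quotient.mk_eq_zero, ← mul_assoc]
      exact Submodule.subset_span ⟨(a * b, c), rfl⟩
    · rw [if_neg (fun h' => h (e.mp h')), if_neg h, sub_self]
  have hu : f u = 0 := by rw [hf, LinearMap.zero_apply]
  have hm : preAct k M x u (Finsupp.single (b * (c : F)) 1 - Finsupp.single b (χ c : k)) ∈
      inducedRel x χ := (Submodule.Quotient.mk_eq_zero _).mp hu
  exact hm

/-- The module `V̂ = kF ⊗_{kF_x} V` of the bismash product induced from the character `χ` of `F_x`,
with the action `(p_y # a) · (b ⊗ v) = δ_{y ◁ (ab), x} (ab ⊗ v)`. -/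
def inducedRep (x : G) (χ : M.stab x →* kˣ) : Bismash k M →ₐ[k] Module.End k (Induced x χ) :=
  AlgHom.ofLinearMap
    { toFun := fun u => (inducedRel x χ).mapQ (inducedRel x χ) (preRep k M x u)
        (preRep_inducedRel x χ u)
      map_add' := fun u v => by
        refine Submodule.linearMap_qext _ (LinearMap.ext fun w => ?_)
        simp
      map_smul' := fun r u => by
        refine Submodule.linearMap_qext _ (LinearMap.ext fun w => ?_)
        simp }
    (by
      refine Submodule.linearMap_qext _ (LinearMap.ext fun w => ?_)
      simp)
    (fun u v => by
      refine Submodule.linearMap_qext _ (LinearMap.ext fun w => ?_)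
      simp)

variable (k M) in
/-- The number of pairs `(x, χ)`, with `x ∈ G` and `χ` a character of `F_x`, for which the induced
module is an irreducible representation of dimension `d` with indicator `c`. For abelian `F` and
algebraically closed `k` these characters are the irreducible representations of `F_x`. -/
def numInduced (d : ℕ) (c : k) : ℕ :=
  Set.ncard {p : (x : G) × (M.stab x →* kˣ) | IsIrrep (inducedRep p.1 p.2) ∧
    Module.finrank k (Induced p.1 p.2) = d ∧ HasIndicator (inducedRep p.1 p.2) c}

end

end Bismash

/-! ### The Hopf algebra `J_n` -/

section Jn

/-- The standard `n`-cycle `i ↦ i + 1`, where `S_n` is the group of permutations of `ℤ/n`. -/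
def cycleA (n : ℕ) : Equiv.Perm (ZMod n) := Equiv.addRight 1

/-- `C_n`, the subgroup of `S_n` generated by the standard `n`-cycle. -/
abbrev Cn (n : ℕ) : Subgroup (Equiv.Perm (ZMod n)) := Subgroup.zpowers (cycleA n)

/-- `S_{n-1}`, the subgroup of `S_n` fixing `n = 0`. -/
abbrev Sn1 (n : ℕ) : Subgroup (Equiv.Perm (ZMod n)) :=
  MulAction.stabilizer (Equiv.Perm (ZMod n)) (0 : ZMod n)

theorem cycleA_zpow_apply (n : ℕ) (z : ℤ) (i : ZMod n) : (cycleA n ^ z) i = i + z := by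
  simp [cycleA]

theorem isComplement_Cn_Sn1 (n : ℕ) :
    Subgroup.IsComplement (Cn n : Set (Equiv.Perm (ZMod n))) (Sn1 n : Set _) := by
  refine Subgroup.isComplement'_stabilizer (0 : ZMod n) ?_ ?_
  · rintro ⟨_, z, rfl⟩ h
    have h0 : (cycleA n ^ z) 0 = 0 := h
    rw [cycleA_zpow_apply, zero_add] at h0
    refine Subtype.ext (Equiv.ext fun i => ?_)
    change (cycleA n ^ z) i = i
    rw [cycleA_zpow_apply, h0, add_zero]
  · intro g
    refine ⟨⟨cycleA n ^ (-((g 0).cast : ℤ)), ⟨_, rfl⟩⟩, ?_⟩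
    change (cycleA n ^ (-((g 0).cast : ℤ))) (g 0) = 0
    rw [cycleA_zpow_apply]
    simp

/-- The matched pair of the factorization `S_n = C_n S_{n-1}`. -/
def matchedPairSn (n : ℕ) : MatchedPair (Cn n) (Sn1 n) :=
  MatchedPair.ofComplement (isComplement_Cn_Sn1 n)

instance (n : ℕ) [NeZero n] : Fintype (Sn1 n) := Fintype.ofFinite _

/-- The Hopf algebra `J_n = k^{S_{n-1}} # kC_n`. -/
abbrev Jn (k : Type*) [Field k] (n : ℕ) := Bismash k (matchedPairSn n)

/-- The set `M_{n/t}` of all `x ∈ S_{n-1}` with stabilizer `F_x = ⟨a^t⟩`. -/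
def stabSet (n t : ℕ) : Set (Sn1 n) :=
  {x | (matchedPairSn n).stab x =
    Subgroup.zpowers ((⟨cycleA n, Subgroup.mem_zpowers _⟩ : Cn n) ^ t)}

end Jn

/-! ### The arithmetic sets and values; here `m` stands for `n / 2` -/

/-- `E_m = {1 ≤ j ≤ m | j² ≡ 1 mod m}`. -/
def setE (m : ℕ) : Finset ℕ := (Finset.Icc 1 m).filter fun j => j ^ 2 ≡ 1 [MOD m]

/-- `K_{j,m} = {1 ≤ u ≤ m | u (j + 1) ≡ 0 mod m}`. -/
def setK (j m : ℕ) : Finset ℕ := (Finset.Icc 1 m).filter fun u => u * (j + 1) ≡ 0 [MOD m]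

/-- `K'_{j,m} = {1 ≤ u ≤ m | (u + 1) (j - 1) ≡ 0 mod m}`. -/
def setK' (j m : ℕ) : Finset ℕ :=
  (Finset.Icc 1 m).filter fun u => ((u : ℤ) + 1) * ((j : ℤ) - 1) ≡ 0 [ZMOD m]

/-- `α_{j,m} = gcd(j + 1, m)`. -/
def alpha (j m : ℕ) : ℕ := Nat.gcd (j + 1) m

/-- `1` if `j ≢ 2u + 1 mod m` and `0` otherwise. -/
def deltaBar (u j m : ℕ) : ℕ := if j ≡ 2 * u + 1 [MOD m] then 0 else 1

/-- `1` if `-i (u + 1) ≡ 0 mod m` and `0` otherwise. -/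
def deltaZero (i u m : ℕ) : ℕ := if -(i : ℤ) * ((u : ℤ) + 1) ≡ 0 [ZMOD m] then 1 else 0

/-- `1` if `-i (u + 1) ≢ 0 mod m` and `0` otherwise. -/
def deltaNonzero (i u m : ℕ) : ℕ := if -(i : ℤ) * ((u : ℤ) + 1) ≡ 0 [ZMOD m] then 0 else 1

end

/-! Write n = 2m and identify C_n with the translations of ℤ/n. Evaluating the factorization
pointwise gives x ▷ s = x(s) and (x ◁ s)(i) = x(i + s) - x(s), so F_x consists of the s along which
x is additive.

For any matched pair the induced modules are irreducible of dimension [F : F_x]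
(`isIrrep_inducedRep`, `finrank_induced`). For F finite cyclic and k algebraically closed they
exhaust the irreducibles (`exists_induced_equiv`). For F commutative, two are isomorphic exactly
when the permutations share an F-orbit and the characters agree (`exists_equiv_induced_iff`).
Dimension 2 thus means F_x = ⟨a²⟩, and additivity along even translations forces x(2t) = 2jt, x(2t +
1) = 2(jt + u) + 1 with j a unit mod m (`exists_affinePerm`). Odd translations replace u by j - u -
1, so the stabilizer is exactly ⟨a²⟩ iff j ≠ 2u + 1. With a primitive additive character ψ of ℤ/m
fixed, the pairs (x, χ) become triples (j, u, i).

Expanding Λ₁Λ₂ makes the indicator |F|⁻¹ times a sum of χ((y ▷ b)b) over y in the orbit of x and b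
with y ◁ b = y⁻¹ (`hasIndicator_inducedRep_iff`). Such b exist only if j² = 1, together with u(j +
1) = 0 for even b or (u + 1)(j - 1) = 0 for odd b. These two conditions differ by j - 2u - 1, so
they exclude each other. The sum over b of one parity vanishes unless i(j + 1) = 0; otherwise the
indicator is 1 in the even case and ψ(i(u + 1)) = ±1 in the odd case (`hasIndicator_affinePerm`).

The formulas count triples by this value. Isomorphism classes are the orbits of the fixed-point-free
involution u ↦ j - u - 1, whence the factor one half. -/

noncomputable section

/-! ### Invariance of irreducibility and indicator under isomorphism -/

section Transport

variable {k : Type*} [Field k] {A : Type*} [Ring A] {V W : Type*} [AddCommGroup V] [Module k V]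
  [AddCommGroup W] [Module k W]

theorem IsIrrep.of_equiv [Algebra k A] {ρ : A →ₐ[k] Module.End k V} {σ : A →ₐ[k] Module.End k W}
    (e : V ≃ₗ[k] W) (he : ∀ a v, e (ρ a v) = σ a (e v)) (h : IsIrrep ρ) : IsIrrep σ := by
  obtain ⟨hV, hρ⟩ := h
  refine ⟨e.symm.toEquiv.nontrivial, fun U hU => ?_⟩
  rcases hρ (U.comap (e : V →ₗ[k] W)) (fun a v hv => by
    simpa [he] using hU a _ hv) with h | h
  · left
    rw [eq_bot_iff]
    intro w hw
    have h0 : e.symm w ∈ U.comap (e : V →ₗ[k] W) := by simpa using hw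
    rw [h, Submodule.mem_bot] at h0
    simpa using h0
  · right
    rw [eq_top_iff]
    intro w _
    have h0 : e.symm w ∈ U.comap (e : V →ₗ[k] W) := h ▸ Submodule.mem_top
    simpa using h0

theorem HasIndicator.of_equiv [HopfAlgebra k A] {ρ : A →ₐ[k] Module.End k V}
    {σ : A →ₐ[k] Module.End k W} (e : V ≃ₗ[k] W) (he : ∀ a v, e (ρ a v) = σ a (e v)) {c : k}
    (h : HasIndicator ρ c) : HasIndicator σ c := by
  obtain ⟨Λ, hΛ, rfl⟩ := h
  refine ⟨Λ, hΛ, ?_⟩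
  rw [← LinearMap.trace_conj' _ e]
  congr 1
  ext w
  simp [LinearEquiv.conj_apply, he]

end Transport

/-! ### Induced modules of a bismash product: basis, irreducibility, indicator -/

namespace Bismash

variable {k : Type*} [Field k] {F G : Type*} [Group F] [Group G] {M : MatchedPair F G}

/-- The image of `b ⊗ 1` in the induced module. -/
def inducedMk (x : G) (χ : M.stab x →* kˣ) (b : F) : Induced x χ :=
  (inducedRel x χ).mkQ (Finsupp.single b 1)

theorem inducedMk_mul (x : G) (χ : M.stab x →* kˣ) (b : F) (c : M.stab x) :
    inducedMk x χ (b * c) = (χ c : k) • inducedMk x χ b := by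
  rw [inducedMk, inducedMk, ← map_smul, ← sub_eq_zero, ← map_sub, Submodule.mkQ_apply,
    Submodule.Quotient.mk_eq_zero]
  refine Submodule.subset_span ⟨(b, c), ?_⟩
  simp

theorem induced_hom_ext {x : G} {χ : M.stab x →* kˣ} {N : Type*} [AddCommGroup N] [Module k N]
    {f g : Induced x χ →ₗ[k] N} (h : ∀ b, f (inducedMk x χ b) = g (inducedMk x χ b)) : f = g := by
  refine Submodule.linearMap_qext _ (Finsupp.lhom_ext' fun b => LinearMap.ext_ring ?_)
  exact h b

/-- A map from the induced module, given on the elements `b ⊗ 1`. -/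
def inducedLift {x : G} {χ : M.stab x →* kˣ} {N : Type*} [AddCommGroup N] [Module k N]
    (f : F → N) (hf : ∀ (b : F) (c : M.stab x), f (b * c) = (χ c : k) • f b) :
    Induced x χ →ₗ[k] N :=
  (inducedRel x χ).liftQ (Finsupp.linearCombination k f) (by
    rw [inducedRel, Submodule.span_le]
    rintro _ ⟨⟨b, c⟩, rfl⟩
    simp [hf])

theorem inducedLift_mk {x : G} {χ : M.stab x →* kˣ} {N : Type*} [AddCommGroup N] [Module k N]
    (f : F → N) (hf : ∀ (b : F) (c : M.stab x), f (b * c) = (χ c : k) • f b) (b : F) :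
    inducedLift f hf (inducedMk x χ b) = f b := by
  simp [inducedLift, inducedMk]

theorem out_inv_mul_mem (H : Subgroup F) (b : F) : (b : F ⧸ H).out⁻¹ * b ∈ H :=
  QuotientGroup.eq.mp (QuotientGroup.out_eq' _)

/-- The basis of the induced module indexed by the cosets of the stabilizer. -/
def inducedBasis (x : G) (χ : M.stab x →* kˣ) : Module.Basis (F ⧸ M.stab x) k (Induced x χ) :=
  .ofRepr <| LinearEquiv.ofLinearMap
    -- If r represents the coset of b, then b = rc with c = r⁻¹b in F_x, so b ⊗ 1 = χ(c)(r ⊗ 1).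
    (inducedLift (fun b => Finsupp.single (b : F ⧸ M.stab x)
      (χ ⟨(b : F ⧸ M.stab x).out⁻¹ * b, out_inv_mul_mem _ b⟩ : k)) (fun b c => by
        have hq : ((b * c : F) : F ⧸ M.stab x) = b := by
          rw [QuotientGroup.eq]
          simp
        -- The coset becomes a variable `q` because the membership proof inside `χ` depends on it
        -- and blocks direct rewriting.
        have hχ : ∀ (q : F ⧸ M.stab x) (hq : q = b) (h : q.out⁻¹ * (b * c) ∈ M.stab x),
            χ ⟨q.out⁻¹ * (b * c), h⟩ =
              χ ⟨(b : F ⧸ M.stab x).out⁻¹ * b, out_inv_mul_mem _ b⟩ * χ c := by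
          rintro q rfl h
          rw [← map_mul]
          congr 1
          exact Subtype.ext (mul_assoc _ _ _).symm
        rw [hχ _ hq]
        rw [hq]
        simp [mul_comm]))
    (Finsupp.linearCombination k fun q => inducedMk x χ q.out)
    (by
      refine Finsupp.lhom_ext' fun q => LinearMap.ext_ring ?_
      simp only [LinearMap.comp_apply, Finsupp.lsingle_apply, Finsupp.linearCombination_single,
        one_smul, inducedLift_mk, LinearMap.id_apply]
      have h : (⟨((q.out : F) : F ⧸ M.stab x).out⁻¹ * q.out, out_inv_mul_mem _ q.out⟩ :
          M.stab x) = 1 := by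
        refine Subtype.ext ?_
        change ((q.out : F) : F ⧸ M.stab x).out⁻¹ * q.out = 1
        rw [QuotientGroup.out_eq']
        simp
      rw [h, QuotientGroup.out_eq']
      simp)
    (by
      refine induced_hom_ext fun b => ?_
      rw [LinearMap.comp_apply, inducedLift_mk, Finsupp.linearCombination_single,
        ← inducedMk_mul]
      simp)

theorem inducedBasis_apply (x : G) (χ : M.stab x →* kˣ) (q : F ⧸ M.stab x) :
    inducedBasis x χ q = inducedMk x χ q.out := by
  simp [inducedBasis]

theorem inducedBasis_repr_mk (x : G) (χ : M.stab x →* kˣ) (b : F) :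
    (inducedBasis x χ).repr (inducedMk x χ b) = Finsupp.single (b : F ⧸ M.stab x)
      (χ ⟨(b : F ⧸ M.stab x).out⁻¹ * b, out_inv_mul_mem _ b⟩ : k) := by
  simp [inducedBasis, inducedLift_mk]

theorem inducedMk_ne_zero (x : G) (χ : M.stab x →* kˣ) (b : F) : inducedMk x χ b ≠ 0 := by
  intro h
  have h' := inducedBasis_repr_mk x χ b
  rw [h, map_zero] at h'
  exact (χ _).ne_zero (Finsupp.single_eq_zero.mp h'.symm)

theorem finrank_induced (x : G) (χ : M.stab x →* kˣ) :
    Module.finrank k (Induced x χ) = (M.stab x).index :=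
  Module.finrank_eq_nat_card_basis (inducedBasis x χ)

/-- The elements carrying z to x form a single coset of F_x; hence p_z # 1 sees only one basis
vector of the induced module. -/
theorem actG_eq_iff_coset {x z : G} {b b' : F} (h : M.actG z b = x) :
    M.actG z b' = x ↔ (b : F ⧸ M.stab x) = b' := by
  rw [QuotientGroup.eq]
  change _ ↔ M.actG x (b⁻¹ * b') = x
  rw [M.actG_mul, ← h, M.actG_mul_inv, h]

open Classical in
/-- The trace of `(p_{y⁻¹} # (y ▷ b))(p_y # b)` on the module induced from `χ`. -/
def indicatorTerm (x : G) (χ : M.stab x →* kˣ) (y : G) (b : F) : k :=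
  if M.actG y b = y⁻¹ ∧ ∃ d, M.actG y d = x then
    if h : M.actF y b * b ∈ M.stab x then (χ ⟨_, h⟩ : k) else 0
  else 0

theorem indicatorTerm_eq_zero_of_ne (x : G) (χ : M.stab x →* kˣ) {y : G} {b : F}
    (h : M.actG y b ≠ y⁻¹) : indicatorTerm x χ y b = 0 :=
  if_neg fun h' => h h'.1

theorem indicatorTerm_eq_zero_of_notMem (x : G) (χ : M.stab x →* kˣ) {y : G} (b : F)
    (h : ¬ ∃ d, M.actG y d = x) : indicatorTerm x χ y b = 0 :=
  if_neg fun h' => h h'.2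

/-- The product is named `c` through an equation so that it can be put in normal form without
rewriting inside a membership proof. -/
theorem indicatorTerm_of_eq {x : G} (χ : M.stab x →* kˣ) {y : G} {b c : F}
    (h : M.actG y b = y⁻¹) (h' : ∃ d, M.actG y d = x) (hc : M.actF y b * b = c)
    (hmem : c ∈ M.stab x) : indicatorTerm x χ y b = χ ⟨c, hmem⟩ := by
  subst hc
  rw [indicatorTerm, if_pos ⟨h, h'⟩, dif_pos hmem]

section

variable [Fintype G]

open Classical in
theorem inducedRep_elt_mk (x : G) (χ : M.stab x →* kˣ) (y : G) (a b : F) :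
    inducedRep x χ (elt k M y a) (inducedMk x χ b) =
      if M.actG y (a * b) = x then inducedMk x χ (a * b) else 0 := by
  change (inducedRel x χ).mkQ (preAct k M x (elt k M y a) (Finsupp.single b 1)) = _
  rw [preAct_elt]
  split_ifs
  · rfl
  · simp

/-- The idempotent p_{x ◁ q⁻¹} # 1 projects onto the basis line of the coset q, so a nonzero
invariant subspace contains some basis vector; F permutes the cosets transitively, so it contains
them all. -/
theorem isIrrep_inducedRep (x : G) (χ : M.stab x →* kˣ) : IsIrrep (inducedRep x χ) := by
  classical
  refine ⟨⟨inducedMk x χ 1, 0, inducedMk_ne_zero x χ 1⟩, fun W hW => ?_⟩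
  rw [or_iff_not_imp_left]
  intro hne
  obtain ⟨w, hw, hw0⟩ := Submodule.exists_mem_ne_zero_of_ne_bot hne
  obtain ⟨q, hq⟩ : ∃ q, (inducedBasis x χ).repr w q ≠ 0 := by
    by_contra! h
    exact hw0 ((inducedBasis x χ).repr.map_eq_zero_iff.mp (Finsupp.ext h))
  have hz : M.actG (M.actG x q.out⁻¹) q.out = x := M.actG_inv_mul x q.out
  have hproj : ∀ v, inducedRep x χ (elt k M (M.actG x q.out⁻¹) 1) v =
      (inducedBasis x χ).repr v q • inducedMk x χ q.out := fun v => by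
    have : inducedRep x χ (elt k M (M.actG x q.out⁻¹) 1) =
        ((inducedBasis x χ).coord q).smulRight (inducedMk x χ q.out) := by
      refine (inducedBasis x χ).ext fun r => ?_
      rw [inducedBasis_apply, inducedRep_elt_mk, one_mul]
      have h := actG_eq_iff_coset (b' := r.out) hz
      rw [QuotientGroup.out_eq', QuotientGroup.out_eq'] at h
      rw [← inducedBasis_apply, ← inducedBasis_apply]
      by_cases hr : q = r
      · subst hr
        simp [hz]
      · simp [h, hr]
    rw [this]
    rfl
  have hmem : inducedMk x χ q.out ∈ W := by
    have h := hW (elt k M (M.actG x q.out⁻¹) 1) w hw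
    rw [hproj] at h
    exact (W.smul_mem_iff hq).mp h
  rw [eq_top_iff, ← (inducedBasis x χ).span_eq, Submodule.span_le]
  rintro _ ⟨r, rfl⟩
  -- This element carries the basis vector of `q` to that of `r`.
  have h := hW (elt k M (M.actG x r.out⁻¹) (r.out * q.out⁻¹)) _ hmem
  rw [inducedRep_elt_mk, inv_mul_cancel_right, if_pos (M.actG_inv_mul x r.out)] at h
  rwa [inducedBasis_apply]

open Classical in
-- By commutativity c fixes either every coset of F_x or none, the former iff c ∈ F_x. Then p_z
-- keeps at most one coset, whose diagonal entry is χ(c).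
theorem trace_inducedRep_elt [Finite F] (hcomm : ∀ a b : F, a * b = b * a) (x : G)
    (χ : M.stab x →* kˣ) (z : G) (c : F) :
    LinearMap.trace k _ (inducedRep x χ (elt k M z c)) =
      if h : c ∈ M.stab x then if ∃ b, M.actG z b = x then (χ ⟨c, h⟩ : k) else 0 else 0 := by
  have := Fintype.ofFinite (F ⧸ M.stab x)
  rw [LinearMap.trace_eq_matrix_trace k (inducedBasis x χ), Matrix.trace]
  simp only [Matrix.diag_apply, LinearMap.toMatrix_apply, inducedBasis_apply, inducedRep_elt_mk]
  have hc : ∀ b : F, ((c * b : F) : F ⧸ M.stab x) = b ↔ c ∈ M.stab x := fun b => by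
    rw [eq_comm, QuotientGroup.eq, hcomm c, inv_mul_cancel_left]
  split_ifs with h h'
  · obtain ⟨b, hb⟩ := h'
    have hb' : ∀ q : F ⧸ M.stab x, M.actG z (c * q.out) = x ↔ q = b := fun q => by
      rw [actG_eq_iff_coset hb, (hc _).mpr h |> fun e => (by rw [e] :
        (((b : F) : F ⧸ M.stab x) = ((c * q.out : F) : F ⧸ M.stab x)) ↔
          ((b : F) : F ⧸ M.stab x) = (q.out : F)), QuotientGroup.out_eq', eq_comm]
    simp only [hb']
    rw [Finset.sum_eq_single (b : F ⧸ M.stab x) (fun q _ hq => by simp [hq]) (by simp)]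
    rw [if_pos rfl, hcomm, inducedMk_mul x χ _ ⟨c, h⟩, map_smul, ← inducedBasis_apply]
    simp
  · refine Finset.sum_eq_zero fun q _ => ?_
    rw [if_neg fun hq => h' ⟨_, hq⟩]
    simp
  · refine Finset.sum_eq_zero fun q _ => ?_
    split_ifs
    · rw [inducedBasis_repr_mk, Finsupp.single_apply, if_neg]
      intro hq
      apply h
      rw [← hc q.out, hq, QuotientGroup.out_eq']
    · simp

variable (k M) in
/-- The normalized integral `|F|⁻¹ ∑_b p_1 # b`. -/
def integral [Fintype F] : Bismash k M := (Fintype.card F : k)⁻¹ • ∑ b : F, elt k M 1 b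

theorem isNormalizedIntegral_integral [Fintype F] [CharZero k] :
    IsNormalizedIntegral k (integral k M) := by
  classical
  refine ⟨fun u => ?_, fun u => ?_, ?_⟩
  · have h : LinearMap.mulRight k (integral k M) =
        (Coalgebra.counit (R := k) (A := Bismash k M)).smulRight (integral k M) := by
      refine ext_elt fun x a => ?_
      simp only [LinearMap.mulRight_apply, LinearMap.smulRight_apply, counit_elt, integral,
        mul_smul_comm, Finset.mul_sum, elt_mul_elt]
      by_cases hx : x = 1
      · subst hx
        simp only [M.one_actG, if_true, one_smul]
        congr 1
        exact Fintype.sum_equiv (Equiv.mulLeft a) _ _ fun b => rfl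
      · have h1 : ¬ 1 = M.actG x a := fun h => hx (M.actG_injective a (by
          simpa [M.one_actG] using h.symm))
        simp [hx, h1]
    exact congrArg (fun f => f u) h
  · have h : LinearMap.mulLeft k (integral k M) =
        (Coalgebra.counit (R := k) (A := Bismash k M)).smulRight (integral k M) := by
      refine ext_elt fun x a => ?_
      simp only [LinearMap.mulLeft_apply, LinearMap.smulRight_apply, counit_elt, integral,
        smul_mul_assoc, Finset.sum_mul, elt_mul_elt, M.one_actG]
      by_cases hx : x = 1
      · simp only [hx, if_true, one_smul]
        congr 1
        exact Fintype.sum_equiv (Equiv.mulRight a) _ _ fun b => rfl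
      · simp [hx]
    exact congrArg (fun f => f u) h
  · have : (Fintype.card F : k) ≠ 0 := Nat.cast_ne_zero.mpr Fintype.card_ne_zero
    simp [integral, counit_elt, this]

open Classical in
-- Since y⁻¹ ◁ (y ▷ b) = (y ◁ b)⁻¹, the product of the two tensor factors survives exactly when y ◁
-- b = y⁻¹.
theorem mul_comul_integral [Fintype F] :
    LinearMap.mul' k (Bismash k M) (Coalgebra.comul (R := k) (integral k M)) =
      (Fintype.card F : k)⁻¹ • ∑ b : F, ∑ y : G,
        if M.actG y b = y⁻¹ then elt k M y⁻¹ (M.actF y b * b) else 0 := by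
  have h : ∀ (y : G) (b : F), M.actG y⁻¹ (M.actF y b) = (M.actG y b)⁻¹ := fun y b => by
    rw [eq_inv_iff_mul_eq_one, ← M.mul_actG, inv_mul_cancel, M.one_actG]
  simp only [integral, map_smul, map_sum, comul_elt, LinearMap.mul'_apply, one_mul, elt_mul_elt, h]
  congr 1
  refine Finset.sum_congr rfl fun b _ => Finset.sum_congr rfl fun y _ => ?_
  by_cases hy : M.actG y b = y⁻¹
  · rw [if_pos hy, if_pos (by rw [hy, inv_inv])]
  · rw [if_neg hy, if_neg fun h' => hy (inv_eq_iff_eq_inv.mpr h').symm]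

theorem hasIndicator_inducedRep_iff [Fintype F] [CharZero k] (hcomm : ∀ a b : F, a * b = b * a)
    (x : G) (χ : M.stab x →* kˣ) (c : k) :
    HasIndicator (inducedRep x χ) c ↔
      (Fintype.card F : k)⁻¹ * ∑ y : G, ∑ b : F, indicatorTerm x χ y b = c := by
  classical
  have key : LinearMap.trace k _ (inducedRep x χ (LinearMap.mul' k (Bismash k M)
      (Coalgebra.comul (R := k) (integral k M)))) =
      (Fintype.card F : k)⁻¹ * ∑ y : G, ∑ b : F, indicatorTerm x χ y b := by
    rw [mul_comul_integral, Finset.sum_comm]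
    simp only [map_smul, map_sum, smul_eq_mul]
    congr 1
    refine Finset.sum_congr rfl fun y _ => Finset.sum_congr rfl fun b _ => ?_
    by_cases hy : M.actG y b = y⁻¹
    · have h : (∃ b, M.actG y⁻¹ b = x) ↔ ∃ b, M.actG y b = x := by
        constructor
        · rintro ⟨d, hd⟩
          exact ⟨b * d, by rw [M.actG_mul, hy, hd]⟩
        · rintro ⟨d, hd⟩
          exact ⟨b⁻¹ * d, by rw [M.actG_mul, ← hy, M.actG_mul_inv, hd]⟩
      by_cases hd : ∃ b, M.actG y b = x
      · simp only [indicatorTerm, hy, if_true, trace_inducedRep_elt hcomm, h, hd, and_self]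
      · simp [indicatorTerm, hy, trace_inducedRep_elt hcomm, h, hd]
    · rw [if_neg hy, indicatorTerm_eq_zero_of_ne x χ hy]
      simp
  rw [← key]
  constructor
  · intro h
    exact HasIndicator.unique ⟨_, isNormalizedIntegral_integral, rfl⟩ h
  · intro h
    exact ⟨_, isNormalizedIntegral_integral, h⟩

/-! ### Irreducible modules are induced; isomorphisms between induced modules -/

section Classification

variable {V : Type*} [AddCommGroup V] [Module k V] {ρ : Bismash k M →ₐ[k] Module.End k V}

/-- Frobenius reciprocity followed by Schur's lemma: a vector of V on which F_x acts through χ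
defines b ⊗ 1 ↦ (p_{x ◁ b⁻¹} # b)v. This is a nonzero homomorphism between irreducible modules,
hence bijective. The index x ◁ b⁻¹ is the only y with y ◁ b = x. -/
theorem exists_equiv_of_eigenvector (hρ : IsIrrep ρ) {x : G} (χ : M.stab x →* kˣ) {v : V}
    (hv0 : v ≠ 0) (hv : ∀ c : M.stab x, ρ (elt k M x c) v = (χ c : k) • v) :
    ∃ e : Induced x χ ≃ₗ[k] V, ∀ u w, e (inducedRep x χ u w) = ρ u (e w) := by
  classical
  let f : F → V := fun b => ρ (elt k M (M.actG x b⁻¹) b) v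
  have hf : ∀ (b : F) (c : M.stab x), f (b * c) = (χ c : k) • f b := fun b c => by
    have hc : M.actG x (c : F)⁻¹ = x := (M.stab x).inv_mem c.2
    have : elt k M (M.actG x (b * c)⁻¹) (b * c) =
        elt k M (M.actG x b⁻¹) b * elt k M x c := by
      rw [elt_mul_elt, if_pos (M.actG_inv_mul x b).symm, mul_inv_rev, M.actG_mul, hc]
    simp only [f]
    rw [this, map_mul, Module.End.mul_apply, hv, map_smul]
  let φ : Induced x χ →ₗ[k] V := inducedLift f hf
  have hφ : ∀ b, φ (inducedMk x χ b) = f b := inducedLift_mk f hf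
  have hint : ∀ u w, φ (inducedRep x χ u w) = ρ u (φ w) := by
    intro u w
    have h : ((LinearMap.llcomp k (Induced x χ) (Induced x χ) V φ) ∘ₗ
        (inducedRep x χ).toLinearMap) = (LinearMap.lcomp k V φ) ∘ₗ ρ.toLinearMap := by
      refine ext_elt fun y a => induced_hom_ext fun b => ?_
      simp only [LinearMap.comp_apply, LinearMap.llcomp_apply, AlgHom.toLinearMap_apply,
        inducedRep_elt_mk, LinearMap.lcomp_apply, hφ]
      simp only [f]
      rw [← Module.End.mul_apply, ← map_mul, elt_mul_elt]
      have e : M.actG x b⁻¹ = M.actG y a ↔ M.actG y (a * b) = x := by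
        rw [M.actG_mul]
        constructor
        · intro h
          rw [← h, M.actG_inv_mul]
        · intro h
          rw [← h, M.actG_mul_inv]
      by_cases hx : M.actG y (a * b) = x
      · rw [if_pos hx, if_pos (e.mpr hx), hφ]
        simp only [f]
        rw [← hx, M.actG_mul_inv]
      · rw [if_neg hx, if_neg fun h => hx (e.mp h)]
        simp
    exact congrArg (fun f => f u w) h
  have h1 : φ (inducedMk x χ 1) = v := by
    rw [hφ]
    simp only [f, inv_one, M.actG_one]
    have := hv 1
    simpa using this
  have hker : LinearMap.ker φ = ⊥ := by
    refine ((isIrrep_inducedRep x χ).2 (LinearMap.ker φ) fun u w hw => ?_).resolve_right ?_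
    · rw [LinearMap.mem_ker] at hw ⊢
      rw [hint, hw, map_zero]
    · intro h
      exact hv0 (by rw [← h1]; exact LinearMap.mem_ker.mp (h ▸ Submodule.mem_top))
  have hran : LinearMap.range φ = ⊤ := by
    refine (hρ.2 (LinearMap.range φ) ?_).resolve_left ?_
    · rintro u _ ⟨w, rfl⟩
      exact ⟨_, hint u w⟩
    · intro h
      have : v ∈ LinearMap.range φ := ⟨_, h1⟩
      rw [h] at this
      exact hv0 ((Submodule.mem_bot k).mp this)
  exact ⟨LinearEquiv.ofBijective φ ⟨LinearMap.ker_eq_bot.mp hker, LinearMap.range_eq_top.mp hran⟩,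
    hint⟩

/-- The idempotents p_x # 1 sum to 1, so one of them acts nontrivially, and its range is a
representation of F_x. As F_x is cyclic, an eigenvector of a generator spans a one-dimensional
subrepresentation, which supplies χ. -/
theorem exists_induced_equiv [IsAlgClosed k] [Finite F] [IsCyclic F] [FiniteDimensional k V]
    (hρ : IsIrrep ρ) : ∃ (x : G) (χ : M.stab x →* kˣ) (e : Induced x χ ≃ₗ[k] V),
      ∀ u w, e (inducedRep x χ u w) = ρ u (e w) := by
  classical
  obtain ⟨x, hx⟩ : ∃ x : G, ρ (elt k M x 1) ≠ 0 := by
    by_contra! h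
    have h1 : ρ 1 = 0 := by rw [one_def, map_sum]; exact Finset.sum_eq_zero fun x _ => h x
    have := hρ.1
    rw [map_one] at h1
    exact one_ne_zero h1
  let T : M.stab x → Module.End k V := fun c => ρ (elt k M x c)
  have hT : ∀ c d, T (c * d) = T c * T d := fun c d => by
    have hc : M.actG x c = x := c.2
    simp only [T]
    rw [← map_mul, elt_mul_elt, hc, if_pos rfl]
    rfl
  let U : Submodule k V := LinearMap.range (T 1)
  have hU : ∀ c v, T c v ∈ U := fun c v => ⟨T c v, by
    rw [← Module.End.mul_apply, ← hT, one_mul]⟩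
  have hU1 : ∀ v ∈ U, T 1 v = v := by
    rintro _ ⟨v, rfl⟩
    rw [← Module.End.mul_apply, ← hT, one_mul]
  have : Nontrivial U := by
    rw [Submodule.nontrivial_iff_ne_bot]
    intro h
    exact hx (LinearMap.range_eq_bot.mp h)
  -- F_x is finite, so natural powers of `g` suffice and the eigenvector property follows by
  -- induction on the exponent.
  obtain ⟨g, hg⟩ := IsCyclic.exists_monoid_generator (α := M.stab x)
  obtain ⟨μ, hμ⟩ := Module.End.exists_eigenvalue ((T g).restrict (p := U) (q := U) fun v _ => hU g v)
  obtain ⟨v, hv⟩ := hμ.exists_hasEigenvector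
  have hv0 : (v : V) ≠ 0 := fun h => hv.2 (Subtype.ext h)
  have hvg : T g v = μ • (v : V) := congrArg Subtype.val hv.apply_eq_smul
  have hall : ∀ c, ∃ r : k, T c v = r • (v : V) := by
    intro c
    obtain ⟨j, rfl⟩ := hg c
    change ∃ r : k, T (g ^ j) v = r • (v : V)
    induction j with
    | zero => exact ⟨1, by rw [pow_zero, hU1 _ v.2, one_smul]⟩
    | succ j ih =>
      obtain ⟨r, hr⟩ := ih
      exact ⟨μ * r, by rw [pow_succ, hT, Module.End.mul_apply, hvg, map_smul, hr, smul_smul]⟩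
  choose r hr using hall
  have hinj : ∀ s t : k, s • (v : V) = t • (v : V) → s = t := fun s t h =>
    smul_left_injective k hv0 h
  let r' : M.stab x →* k :=
    { toFun := r
      map_one' := hinj _ _ (by rw [← hr, hU1 _ v.2, one_smul])
      map_mul' := fun c d => hinj _ _ (by
        rw [← hr, hT, Module.End.mul_apply, hr d, map_smul, hr c, smul_smul, mul_comm]) }
  obtain ⟨e, he⟩ := exists_equiv_of_eigenvector hρ r'.toHomUnits hv0 fun c => hr c
  exact ⟨x, _, e, he⟩

end Classification

/-- For commutative F the stabilizer is constant along an orbit, so comparing χ and ψ on common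
elements compares them entirely. On the module of (y, ψ), p_x # c acts as ψ(c) times p_x # 1, which
vanishes unless x lies in the orbit of y; conversely b ⊗ 1 with x ◁ b = y is an eigenvector with
character χ. -/
theorem exists_equiv_induced_iff (hcomm : ∀ a b : F, a * b = b * a) {x y : G}
    (χ : M.stab x →* kˣ) (ψ : M.stab y →* kˣ) :
    (∃ e : Induced x χ ≃ₗ[k] Induced y ψ, ∀ u w, e (inducedRep x χ u w) = inducedRep y ψ u (e w)) ↔
      (∃ b, M.actG x b = y) ∧
        ∀ c (h : c ∈ M.stab x) (h' : c ∈ M.stab y), χ ⟨c, h⟩ = ψ ⟨c, h'⟩ := by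
  classical
  constructor
  · rintro ⟨e, he⟩
    have hw0 : e (inducedMk x χ 1) ≠ 0 := fun h =>
      inducedMk_ne_zero x χ 1 (e.map_eq_zero_iff.mp h)
    have hw : ∀ c : M.stab x, inducedRep y ψ (elt k M x c) (e (inducedMk x χ 1)) =
        (χ c : k) • e (inducedMk x χ 1) := fun c => by
      have hc : M.actG x c = x := c.2
      rw [← he, inducedRep_elt_mk, mul_one, if_pos hc, ← map_smul, ← inducedMk_mul, one_mul]
    have hw1 := hw 1
    rw [map_one, Units.val_one, one_smul] at hw1
    refine ⟨?_, fun c h h' => ?_⟩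
    · by_contra! hb
      apply hw0
      rw [← hw1]
      have : inducedRep y ψ (elt k M x ((1 : M.stab x) : F)) = 0 := by
        refine induced_hom_ext fun b => ?_
        rw [inducedRep_elt_mk, if_neg (hb _)]
        rfl
      rw [this]
      rfl
    · have : inducedRep y ψ (elt k M x c) =
          (ψ ⟨c, h'⟩ : k) • inducedRep y ψ (elt k M x ((1 : M.stab x) : F)) := by
        refine induced_hom_ext fun b => ?_
        have hx : M.actG x c = x := h
        rw [LinearMap.smul_apply, inducedRep_elt_mk, inducedRep_elt_mk, M.actG_mul, hx,
          OneMemClass.coe_one, one_mul, hcomm]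
        split_ifs
        · exact inducedMk_mul y ψ b ⟨c, h'⟩
        · rw [smul_zero]
      have h2 := hw ⟨c, h⟩
      rw [this, LinearMap.smul_apply, hw1] at h2
      exact Units.ext (smul_left_injective k hw0 h2.symm)
  · rintro ⟨⟨b, rfl⟩, hχ⟩
    refine exists_equiv_of_eigenvector (isIrrep_inducedRep _ ψ) χ
      (inducedMk_ne_zero _ ψ b) fun c => ?_
    have hc : M.actG x c = x := c.2
    have hc' : (c : F) ∈ M.stab (M.actG x b) := by
      change M.actG (M.actG x b) c = M.actG x b
      rw [← M.actG_mul, hcomm, M.actG_mul, hc]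
    rw [inducedRep_elt_mk, if_pos (by rw [M.actG_mul, hc]), hcomm, hχ c c.2 hc']
    exact inducedMk_mul _ ψ b ⟨c, hc'⟩

end

end Bismash

/-! ### Translations and the matched pair -/

section Translations

variable {n : ℕ}

/-- The translation `i ↦ i + s` as an element of `C_n`. -/
def transl (s : ZMod n) : Cn n := ⟨Equiv.addRight s, (s.cast : ℤ), by
  refine Equiv.ext fun i => ?_
  change (cycleA n ^ (s.cast : ℤ)) i = i + s
  rw [cycleA_zpow_apply, ZMod.intCast_zmod_cast]⟩

@[simp]
theorem transl_apply (s i : ZMod n) : (transl s : Equiv.Perm (ZMod n)) i = i + s := rfl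

theorem eq_transl (b : Cn n) : b = transl ((b : Equiv.Perm (ZMod n)) 0) := by
  obtain ⟨_, z, rfl⟩ := b
  refine Subtype.ext (Equiv.ext fun i => ?_)
  change (cycleA n ^ z) i = i + (cycleA n ^ z) 0
  simp only [cycleA_zpow_apply, zero_add]

theorem exists_transl (b : Cn n) : ∃ s, b = transl s := ⟨_, eq_transl b⟩

theorem transl_injective : Function.Injective (transl : ZMod n → Cn n) := fun s t h => by
  have := congrArg (fun b : Cn n => (b : Equiv.Perm (ZMod n)) 0) h
  simpa using this

theorem transl_mul (s t : ZMod n) : transl s * transl t = transl (s + t) :=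
  Subtype.ext (Equiv.ext fun i => by
    change i + t + s = i + (s + t)
    ring)

theorem transl_zero : transl (0 : ZMod n) = 1 := Subtype.ext (Equiv.ext fun i => add_zero i)

theorem Cn_mul_comm (a b : Cn n) : a * b = b * a := by
  obtain ⟨s, rfl⟩ := exists_transl a
  obtain ⟨t, rfl⟩ := exists_transl b
  rw [transl_mul, transl_mul, add_comm]

variable (n) in
/-- `ℤ/n` as the set of translations. -/
def translEquiv : ZMod n ≃ Cn n :=
  Equiv.ofBijective transl ⟨transl_injective, fun b => ⟨_, (eq_transl b).symm⟩⟩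

theorem Sn1_apply_zero (x : Sn1 n) : (x : Equiv.Perm (ZMod n)) 0 = 0 := x.2

theorem matchedPairSn_spec (x : Sn1 n) (b : Cn n) (i : ZMod n) :
    (((matchedPairSn n).actF x b : Cn n) : Equiv.Perm (ZMod n))
      ((((matchedPairSn n).actG x b : Sn1 n) : Equiv.Perm (ZMod n)) i) =
      (x : Equiv.Perm (ZMod n)) ((b : Equiv.Perm (ZMod n)) i) := by
  have h := (isComplement_Cn_Sn1 n).equiv_fst_mul_equiv_snd (x * b)
  exact congrArg (fun f : Equiv.Perm (ZMod n) => f i) h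

/-- The factor x ◁ b fixes 0, so evaluating xb = (x ▷ b)(x ◁ b) at 0 reads off x ▷ b; evaluating
elsewhere then determines x ◁ b. -/
theorem actF_transl (x : Sn1 n) (s : ZMod n) :
    (matchedPairSn n).actF x (transl s) = transl ((x : Equiv.Perm (ZMod n)) s) := by
  have h := matchedPairSn_spec x (transl s) 0
  rw [Sn1_apply_zero, transl_apply, zero_add] at h
  rw [eq_transl ((matchedPairSn n).actF x (transl s)), h]

theorem actG_transl_apply (x : Sn1 n) (s i : ZMod n) :
    (((matchedPairSn n).actG x (transl s) : Sn1 n) : Equiv.Perm (ZMod n)) i =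
      (x : Equiv.Perm (ZMod n)) (i + s) - (x : Equiv.Perm (ZMod n)) s := by
  have h := matchedPairSn_spec x (transl s) i
  rw [actF_transl, transl_apply, transl_apply] at h
  exact eq_sub_of_add_eq h

theorem transl_mem_stab (x : Sn1 n) (s : ZMod n) : transl s ∈ (matchedPairSn n).stab x ↔
    ∀ i, (x : Equiv.Perm (ZMod n)) (i + s) =
      (x : Equiv.Perm (ZMod n)) i + (x : Equiv.Perm (ZMod n)) s := by
  change (matchedPairSn n).actG x (transl s) = x ↔ _
  constructor
  · intro h i
    have h' := actG_transl_apply x s i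
    rw [h] at h'
    rw [h', sub_add_cancel]
  · intro h
    refine Subtype.ext (Equiv.ext fun i => ?_)
    rw [actG_transl_apply, h, add_sub_cancel_right]

end Translations

/-! ### Even and odd residues modulo `2m` -/

section Double

variable (m : ℕ)

/-- The embedding `t ↦ 2t` of `ℤ/m` in `ℤ/2m`. -/
def dbl : ZMod m →+ ZMod (2 * m) :=
  ZMod.lift m ⟨(AddMonoidHom.mulLeft 2).comp (Int.castAddHom (ZMod (2 * m))), by
    have := ZMod.natCast_self (2 * m)
    push_cast at this
    simpa using this⟩

variable {m}

theorem dbl_intCast (z : ℤ) : dbl m (z : ZMod m) = ((2 * z : ℤ) : ZMod (2 * m)) := by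
  simp [dbl]

theorem dbl_one : dbl m 1 = 1 + 1 := by
  have := dbl_intCast (m := m) 1
  push_cast at this
  rw [this]
  norm_num

theorem dbl_injective : Function.Injective (dbl m) := by
  rw [injective_iff_map_eq_zero]
  intro t ht
  obtain ⟨z, rfl⟩ := ZMod.intCast_surjective t
  rw [dbl_intCast, ZMod.intCast_zmod_eq_zero_iff_dvd] at ht
  rw [ZMod.intCast_zmod_eq_zero_iff_dvd]
  push_cast at ht
  exact (mul_dvd_mul_iff_left two_ne_zero).mp ht

/-- Parity is well defined because the modulus 2m is even. -/
theorem dbl_ne_dbl_add_one (s t : ZMod m) : dbl m s ≠ dbl m t + 1 := by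
  intro h
  obtain ⟨y, rfl⟩ := ZMod.intCast_surjective s
  obtain ⟨z, rfl⟩ := ZMod.intCast_surjective t
  rw [dbl_intCast, dbl_intCast] at h
  have h' : ((2 * y - (2 * z + 1) : ℤ) : ZMod (2 * m)) = 0 := by
    push_cast at h ⊢
    rw [h, sub_self]
  rw [ZMod.intCast_zmod_eq_zero_iff_dvd] at h'
  obtain ⟨w, hw⟩ := h'
  push_cast at hw
  have : (2 : ℤ) * (y - z - m * w) = 1 := by linarith
  omega

theorem eq_dbl_or (s : ZMod (2 * m)) : (∃ t, s = dbl m t) ∨ ∃ t, s = dbl m t + 1 := by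
  obtain ⟨z, rfl⟩ := ZMod.intCast_surjective s
  rcases Int.even_or_odd' z with ⟨w, rfl | rfl⟩
  · exact Or.inl ⟨w, (dbl_intCast w).symm⟩
  · exact Or.inr ⟨w, by rw [dbl_intCast]; push_cast; rfl⟩

variable (m) in
/-- The decomposition of `ℤ/2m` into even and odd residues. -/
def parityEquiv : ZMod m ⊕ ZMod m ≃ ZMod (2 * m) :=
  Equiv.ofBijective (Sum.elim (dbl m) fun t => dbl m t + 1) ⟨by
    rintro (s | s) (t | t) h
    · exact congrArg _ (dbl_injective h)
    · exact absurd h (dbl_ne_dbl_add_one s t)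
    · exact absurd h.symm (dbl_ne_dbl_add_one t s)
    · exact congrArg _ (dbl_injective (add_right_cancel h)), by
    intro s
    rcases eq_dbl_or s with ⟨t, rfl⟩ | ⟨t, rfl⟩
    · exact ⟨Sum.inl t, rfl⟩
    · exact ⟨Sum.inr t, rfl⟩⟩

theorem parityEquiv_symm_dbl (t : ZMod m) : (parityEquiv m).symm (dbl m t) = Sum.inl t :=
  (parityEquiv m).symm_apply_apply (Sum.inl t)

theorem parityEquiv_symm_dbl_add_one (t : ZMod m) :
    (parityEquiv m).symm (dbl m t + 1) = Sum.inr t :=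
  (parityEquiv m).symm_apply_apply (Sum.inr t)

/-- The inverse of `dbl` on even residues. -/
def half (s : ZMod (2 * m)) : ZMod m := Sum.elim id id ((parityEquiv m).symm s)

theorem half_dbl (t : ZMod m) : half (dbl m t) = t := by
  rw [half, parityEquiv_symm_dbl]
  rfl

end Double

/-! ### The even translations -/

section EvenTranslations

variable (m : ℕ)

/-- The subgroup of `C_{2m}` of translations by even residues. -/
def evenTransl : Subgroup (Cn (2 * m)) where
  carrier := Set.range fun t => transl (dbl m t)
  one_mem' := ⟨0, by simp [transl_zero]⟩
  mul_mem' := by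
    rintro _ _ ⟨s, rfl⟩ ⟨t, rfl⟩
    exact ⟨s + t, by simp [transl_mul]⟩
  inv_mem' := by
    rintro _ ⟨s, rfl⟩
    exact ⟨-s, eq_inv_of_mul_eq_one_left (by simp [transl_mul, transl_zero])⟩

variable {m}

theorem transl_dbl_mem (t : ZMod m) : transl (dbl m t) ∈ evenTransl m := ⟨t, rfl⟩

theorem transl_dbl_add_one_notMem (t : ZMod m) : transl (dbl m t + 1) ∉ evenTransl m := by
  rintro ⟨s, hs⟩
  exact dbl_ne_dbl_add_one s t (transl_injective hs)

/-- Odd translations differ from `transl 1` by even ones, so a subgroup containing the even ones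
need only be tested at 1. -/
theorem eq_evenTransl_iff (H : Subgroup (Cn (2 * m))) :
    H = evenTransl m ↔ evenTransl m ≤ H ∧ transl 1 ∉ H := by
  constructor
  · rintro rfl
    refine ⟨le_rfl, ?_⟩
    simpa using transl_dbl_add_one_notMem (0 : ZMod m)
  · rintro ⟨hle, h1⟩
    refine le_antisymm (fun b hb => ?_) hle
    obtain ⟨s, rfl⟩ := exists_transl b
    rcases eq_dbl_or s with ⟨t, rfl⟩ | ⟨t, rfl⟩
    · exact transl_dbl_mem t
    · rw [← transl_mul] at hb
      exact absurd ((H.mul_mem_cancel_left (hle (transl_dbl_mem t))).mp hb) h1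

theorem index_evenTransl : (evenTransl m).index = 2 := by
  rw [Subgroup.index_eq_two_iff]
  refine ⟨transl 1, fun b => ?_⟩
  obtain ⟨s, rfl⟩ := exists_transl b
  rcases eq_dbl_or s with ⟨t, rfl⟩ | ⟨t, rfl⟩
  · refine Or.inr ⟨transl_dbl_mem t, ?_⟩
    rw [transl_mul]
    exact transl_dbl_add_one_notMem t
  · refine Or.inl ⟨?_, transl_dbl_add_one_notMem t⟩
    rw [transl_mul, add_assoc, ← dbl_one, ← map_add]
    exact transl_dbl_mem _

/-- A subgroup of index two contains all squares, which here are the even translations, and cannot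
contain the generator `transl 1`. -/
theorem index_eq_two_iff_eq_evenTransl (H : Subgroup (Cn (2 * m))) :
    H.index = 2 ↔ H = evenTransl m := by
  refine ⟨fun h => (eq_evenTransl_iff H).mpr ⟨?_, fun h1 => ?_⟩, fun h => h ▸ index_evenTransl⟩
  · rintro _ ⟨t, rfl⟩
    obtain ⟨z, rfl⟩ := ZMod.intCast_surjective t
    have := Subgroup.mul_self_mem_of_index_two h (transl (z : ZMod (2 * m)))
    rw [transl_mul] at this
    change transl (dbl m z) ∈ H
    rw [dbl_intCast]
    push_cast
    have h2 : (2 : ZMod (2 * m)) * z = z + z := two_mul _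
    rwa [h2]
  · have : H = ⊤ := by
      rw [eq_top_iff]
      intro b _
      obtain ⟨s, rfl⟩ := exists_transl b
      obtain ⟨z, rfl⟩ := ZMod.intCast_surjective s
      have h2 := H.zpow_mem h1 z
      have h3 : ∀ z : ℤ, (transl 1 : Cn (2 * m)) ^ z = transl (z : ZMod (2 * m)) := fun z => by
        refine Subtype.ext (Equiv.ext fun i => ?_)
        exact cycleA_zpow_apply _ z i
      rwa [h3] at h2
    rw [this, Subgroup.index_top] at h
    omega

theorem zpowers_cycleA_sq : Subgroup.zpowers
    ((⟨cycleA (2 * m), Subgroup.mem_zpowers _⟩ : Cn (2 * m)) ^ 2) = evenTransl m := by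
  have h1 : ((⟨cycleA (2 * m), Subgroup.mem_zpowers _⟩ : Cn (2 * m)) ^ 2) = transl (dbl m 1) := by
    rw [dbl_one, ← transl_mul, sq]
    rfl
  rw [h1]
  refine le_antisymm ((Subgroup.zpowers_le).mpr (transl_dbl_mem 1)) ?_
  rintro _ ⟨t, rfl⟩
  obtain ⟨z, rfl⟩ := ZMod.intCast_surjective t
  refine ⟨z, Subtype.ext (Equiv.ext fun i => ?_)⟩
  have h2 : ∀ (z : ℤ) (s : ZMod (2 * m)), (Equiv.addRight s ^ z : Equiv.Perm (ZMod (2 * m))) =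
      Equiv.addRight (z • s) := fun z s => by simp
  change (Equiv.addRight (dbl m 1) ^ z : Equiv.Perm (ZMod (2 * m))) i = i + dbl m z
  rw [h2, ← map_zsmul]
  simp

end EvenTranslations

/-! ### The permutations with stabilizer `⟨a²⟩` -/

section AffinePerm

variable {m : ℕ}

/-- The permutation `2t ↦ 2jt`, `2t + 1 ↦ 2(jt + u) + 1` of `ℤ/2m`. -/
def affinePerm (j : (ZMod m)ˣ) (u : ZMod m) : Sn1 (2 * m) :=
  ⟨(parityEquiv m).symm.trans ((Equiv.sumCongr (Units.mulLeft j)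
    ((Units.mulLeft j).trans (Equiv.addRight u))).trans (parityEquiv m)), by
    change (parityEquiv m) ((Equiv.sumCongr (Units.mulLeft j)
      ((Units.mulLeft j).trans (Equiv.addRight u))) ((parityEquiv m).symm 0)) = 0
    rw [← map_zero (dbl m), parityEquiv_symm_dbl]
    exact congrArg (dbl m) (mul_zero _)⟩

variable (j : (ZMod m)ˣ) (u : ZMod m)

theorem affinePerm_dbl (t : ZMod m) :
    (affinePerm j u : Equiv.Perm (ZMod (2 * m))) (dbl m t) = dbl m (j * t) := by
  change (parityEquiv m) ((Equiv.sumCongr (Units.mulLeft j)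
      ((Units.mulLeft j).trans (Equiv.addRight u))) ((parityEquiv m).symm _)) = _
  rw [parityEquiv_symm_dbl]
  rfl

theorem affinePerm_dbl_add_one (t : ZMod m) :
    (affinePerm j u : Equiv.Perm (ZMod (2 * m))) (dbl m t + 1) = dbl m (j * t + u) + 1 := by
  change (parityEquiv m) ((Equiv.sumCongr (Units.mulLeft j)
      ((Units.mulLeft j).trans (Equiv.addRight u))) ((parityEquiv m).symm _)) = _
  rw [parityEquiv_symm_dbl_add_one]
  rfl

theorem Sn1_ext_parity {x y : Sn1 (2 * m)}
    (h0 : ∀ t, (x : Equiv.Perm (ZMod (2 * m))) (dbl m t) = (y : Equiv.Perm _) (dbl m t))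
    (h1 : ∀ t, (x : Equiv.Perm (ZMod (2 * m))) (dbl m t + 1) = (y : Equiv.Perm _) (dbl m t + 1)) :
    x = y := by
  refine Subtype.ext (Equiv.ext fun s => ?_)
  rcases eq_dbl_or s with ⟨t, rfl⟩ | ⟨t, rfl⟩
  · exact h0 t
  · exact h1 t

theorem affinePerm_inj {j j' : (ZMod m)ˣ} {u u' : ZMod m} :
    affinePerm j u = affinePerm j' u' ↔ j = j' ∧ u = u' := by
  refine ⟨fun h => ⟨?_, ?_⟩, ?_⟩
  · have h1 := affinePerm_dbl j u 1
    rw [h, affinePerm_dbl, mul_one, mul_one] at h1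
    exact Units.ext (dbl_injective h1.symm)
  · have h1 := affinePerm_dbl_add_one j u 0
    rw [h, affinePerm_dbl_add_one, mul_zero, mul_zero, zero_add, zero_add] at h1
    exact dbl_injective (add_right_cancel h1.symm)
  · rintro ⟨rfl, rfl⟩
    rfl

theorem affinePerm_inv : (affinePerm j u)⁻¹ = affinePerm j⁻¹ (-(↑j⁻¹ * u)) := by
  rw [inv_eq_iff_mul_eq_one]
  refine Sn1_ext_parity (fun t => ?_) fun t => ?_
  · change (affinePerm j u : Equiv.Perm (ZMod (2 * m)))
      ((affinePerm j⁻¹ (-(↑j⁻¹ * u)) : Equiv.Perm (ZMod (2 * m))) (dbl m t)) = dbl m t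
    rw [affinePerm_dbl, affinePerm_dbl, Units.mul_inv_cancel_left]
  · change (affinePerm j u : Equiv.Perm (ZMod (2 * m)))
      ((affinePerm j⁻¹ (-(↑j⁻¹ * u)) : Equiv.Perm (ZMod (2 * m))) (dbl m t + 1)) = dbl m t + 1
    rw [affinePerm_dbl_add_one, affinePerm_dbl_add_one, mul_add, mul_neg,
      Units.mul_inv_cancel_left, Units.mul_inv_cancel_left, neg_add_cancel_right]

theorem actG_affinePerm_dbl (t : ZMod m) :
    (matchedPairSn (2 * m)).actG (affinePerm j u) (transl (dbl m t)) = affinePerm j u := by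
  refine Sn1_ext_parity (fun s => ?_) fun s => ?_
  · rw [actG_transl_apply, ← map_add, affinePerm_dbl, affinePerm_dbl, affinePerm_dbl, ← map_sub]
    congr 1
    ring
  · rw [actG_transl_apply, add_right_comm, ← map_add, affinePerm_dbl, affinePerm_dbl_add_one,
      affinePerm_dbl_add_one, add_sub_right_comm, ← map_sub]
    congr 2
    ring

/-- At 2s + 1 the value is x(2(s + t + 1)) - x(2t + 1) = 2(js + j - u - 1) + 1, independently of t.
Hence the orbit has at most two points. -/
theorem actG_affinePerm_dbl_add_one (t : ZMod m) :
    (matchedPairSn (2 * m)).actG (affinePerm j u) (transl (dbl m t + 1)) =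
      affinePerm j (j - u - 1) := by
  refine Sn1_ext_parity (fun s => ?_) fun s => ?_
  · rw [actG_transl_apply, ← add_assoc, ← map_add, affinePerm_dbl, affinePerm_dbl_add_one,
      affinePerm_dbl_add_one, add_sub_add_right_eq_sub, ← map_sub]
    congr 1
    ring
  · rw [actG_transl_apply, add_add_add_comm, ← dbl_one, ← map_add, ← map_add, affinePerm_dbl,
      affinePerm_dbl_add_one, affinePerm_dbl_add_one, sub_eq_iff_eq_add, add_add_add_comm,
      ← dbl_one, ← map_add, ← map_add]
    congr 1
    ring

theorem evenTransl_le_stab : evenTransl m ≤ (matchedPairSn (2 * m)).stab (affinePerm j u) := by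
  rintro _ ⟨t, rfl⟩
  exact actG_affinePerm_dbl j u t

theorem stab_affinePerm_eq_iff :
    (matchedPairSn (2 * m)).stab (affinePerm j u) = evenTransl m ↔ (j : ZMod m) ≠ 2 * u + 1 := by
  rw [eq_evenTransl_iff]
  have h1 : transl 1 ∈ (matchedPairSn (2 * m)).stab (affinePerm j u) ↔
      (j : ZMod m) = 2 * u + 1 := by
    have h := actG_affinePerm_dbl_add_one j u 0
    rw [map_zero, zero_add] at h
    change (matchedPairSn (2 * m)).actG (affinePerm j u) (transl 1) = affinePerm j u ↔ _
    rw [h, affinePerm_inj]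
    constructor
    · rintro ⟨-, h⟩
      linear_combination h
    · intro h
      exact ⟨rfl, by linear_combination h⟩
  rw [h1]
  exact and_iff_right (evenTransl_le_stab j u)

/-- Additivity along even translations makes x a homomorphism on the even residues, and determines x
on the odd ones from x(1). -/
theorem exists_affinePerm [NeZero m] {x : Sn1 (2 * m)}
    (hx : (matchedPairSn (2 * m)).stab x = evenTransl m) : ∃ j u, x = affinePerm j u := by
  have hadd : ∀ i t, (x : Equiv.Perm (ZMod (2 * m))) (i + dbl m t) =
      (x : Equiv.Perm (ZMod (2 * m))) i + (x : Equiv.Perm (ZMod (2 * m))) (dbl m t) := fun i t => by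
    have h := transl_dbl_mem t
    rw [← hx, transl_mem_stab] at h
    exact h i
  let f : ZMod m →+ ZMod (2 * m) :=
    { toFun := fun t => (x : Equiv.Perm (ZMod (2 * m))) (dbl m t)
      map_zero' := by rw [map_zero, Sn1_apply_zero]
      map_add' := fun s t => by rw [map_add, hadd] }
  have hfinj : Function.Injective f := fun s t h =>
    dbl_injective ((x : Equiv.Perm (ZMod (2 * m))).injective h)
  -- The element `f 1` is killed by m in ℤ/2m, so it is even.
  obtain ⟨j, hj⟩ : ∃ j, f 1 = dbl m j := by
    obtain ⟨z, hz⟩ := ZMod.intCast_surjective (f 1)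
    have h0 : m • f 1 = 0 := by
      rw [← map_nsmul]
      simp
    rw [← hz, nsmul_eq_mul] at h0
    have h1 : ((m * z : ℤ) : ZMod (2 * m)) = 0 := by
      push_cast
      exact h0
    rw [ZMod.intCast_zmod_eq_zero_iff_dvd] at h1
    push_cast at h1
    rw [mul_comm, mul_dvd_mul_iff_left (Int.natCast_ne_zero.mpr (NeZero.ne m))] at h1
    obtain ⟨w, rfl⟩ := h1
    exact ⟨w, by rw [← hz, dbl_intCast]⟩
  have hf : ∀ t, f t = dbl m (j * t) := fun t => by
    obtain ⟨z, rfl⟩ := ZMod.intCast_surjective t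
    have : (z : ZMod m) = z • (1 : ZMod m) := by simp
    rw [this, map_zsmul, hj, ← map_zsmul]
    congr 1
    simp [mul_comm]
  -- Multiplication by j inherits injectivity from x; on the finite ring ℤ/m this makes j a unit.
  have hjinj : Function.Injective fun t : ZMod m => j * t := fun s t h => by
    apply hfinj
    rw [hf, hf]
    exact congrArg _ h
  obtain ⟨j', hj'⟩ := Finite.injective_iff_surjective.mp hjinj 1
  let J : (ZMod m)ˣ := ⟨j, j', hj', by rw [mul_comm]; exact hj'⟩
  have hxe : ∀ t, (x : Equiv.Perm (ZMod (2 * m))) (dbl m t) = dbl m (J * t) := hf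
  -- Since j is a unit, x already maps the even residues onto the even residues, so x(1) must be
  -- odd.
  obtain ⟨u, hu⟩ : ∃ u, (x : Equiv.Perm (ZMod (2 * m))) 1 = dbl m u + 1 := by
    rcases eq_dbl_or ((x : Equiv.Perm (ZMod (2 * m))) 1) with ⟨t, ht⟩ | h
    · exfalso
      have h := hxe (↑J⁻¹ * t)
      rw [Units.mul_inv_cancel_left, ← ht] at h
      have := (x : Equiv.Perm (ZMod (2 * m))).injective h
      exact dbl_ne_dbl_add_one ((J⁻¹ : (ZMod m)ˣ) * t : ZMod m) 0 (by rw [this, map_zero, zero_add])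
    · exact h
  refine ⟨J, u, Sn1_ext_parity (fun t => ?_) fun t => ?_⟩
  · rw [hxe, affinePerm_dbl]
  · rw [add_comm, hadd, hu, hxe, add_comm 1, affinePerm_dbl_add_one, map_add]
    ring

end AffinePerm

/-! ### Characters of `⟨a²⟩` -/

section EvenCharacters

variable {m : ℕ} {k : Type*} [Field k]

/-- The character `a^{2t} ↦ φ t` of a stabilizer equal to `⟨a²⟩`. -/
def evenChar {H : Subgroup (Cn (2 * m))} (hH : H = evenTransl m) (φ : AddChar (ZMod m) k) :
    H →* kˣ :=
  MonoidHom.toHomUnits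
    -- A translation is recovered from its value at 0, which is even for elements of H.
    { toFun := fun c => φ (half (((c : Cn (2 * m)) : Equiv.Perm (ZMod (2 * m))) 0))
      map_one' := by
        change φ (half 0) = 1
        rw [← map_zero (dbl m), half_dbl, AddChar.map_zero_eq_one]
      map_mul' := by
        subst hH
        rintro ⟨_, s, rfl⟩ ⟨_, t, rfl⟩
        change φ (half (0 + dbl m t + dbl m s)) = φ (half (0 + dbl m s)) * φ (half (0 + dbl m t))
        rw [zero_add, zero_add, ← map_add, half_dbl, half_dbl, half_dbl, add_comm,
          AddChar.map_add_eq_mul] }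

theorem evenChar_apply {H : Subgroup (Cn (2 * m))} (hH : H = evenTransl m)
    (φ : AddChar (ZMod m) k) (t : ZMod m) (h : transl (dbl m t) ∈ H) :
    (evenChar hH φ ⟨_, h⟩ : k) = φ t := by
  change φ (half (0 + dbl m t)) = φ t
  rw [zero_add, half_dbl]

theorem evenChar_injective {H : Subgroup (Cn (2 * m))} (hH : H = evenTransl m) :
    Function.Injective (evenChar (k := k) hH) := fun φ φ' h => by
  refine DFunLike.ext _ _ fun t => ?_
  have ht : transl (dbl m t) ∈ H := hH ▸ transl_dbl_mem t
  rw [← evenChar_apply hH φ t ht, h, evenChar_apply]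

theorem evenChar_surjective {H : Subgroup (Cn (2 * m))} (hH : H = evenTransl m) :
    Function.Surjective (evenChar (k := k) hH) := fun χ => by
  subst hH
  refine ⟨{ toFun := fun t => χ ⟨_, transl_dbl_mem t⟩
            map_zero_eq_one' := ?_
            map_add_eq_mul' := fun s t => ?_ }, ?_⟩
  · have : (⟨_, transl_dbl_mem 0⟩ : evenTransl m) = 1 :=
      Subtype.ext (by simp [transl_zero])
    rw [this, map_one, Units.val_one]
  · rw [← Units.val_mul, ← map_mul]
    congr 2
    refine Subtype.ext ?_
    change transl (dbl m (s + t)) = transl (dbl m s) * transl (dbl m t)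
    rw [transl_mul, map_add]
  · refine MonoidHom.ext ?_
    rintro ⟨_, t, rfl⟩
    exact Units.ext (evenChar_apply rfl _ t _)

/-- A primitive m-th root of unity ζ gives ψ. Any character takes at 1 some power ζ^i, hence is the
shift of ψ by i; this parametrizes the characters of ⟨a²⟩ by ℤ/m. -/
theorem exists_isPrimitive_addChar [IsAlgClosed k] [CharZero k] [NeZero m] :
    ∃ ψ : AddChar (ZMod m) k, ψ.IsPrimitive ∧ Function.Surjective ψ.mulShift := by
  obtain ⟨ζ, hζ⟩ := HasEnoughRootsOfUnity.exists_primitiveRoot k m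
  refine ⟨AddChar.zmodChar m hζ.pow_eq_one, AddChar.zmodChar_primitive_of_primitive_root m hζ,
    fun φ => ?_⟩
  have h1 : φ 1 ^ m = 1 := by
    rw [← AddChar.map_nsmul_eq_pow]
    simp
  obtain ⟨i, -, hi⟩ := hζ.eq_pow_of_pow_eq_one h1
  refine ⟨i, DFunLike.ext _ _ fun t => ?_⟩
  obtain ⟨t, rfl⟩ := ZMod.natCast_zmod_surjective t
  have ht : (t : ZMod m) = t • (1 : ZMod m) := by simp
  rw [AddChar.mulShift_apply, ← Nat.cast_mul, AddChar.zmodChar_apply', pow_mul, hi, ht,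
    AddChar.map_nsmul_eq_pow]

end EvenCharacters

/-! ### The indicators of the two-dimensional induced modules -/

section Indicator

open Bismash

variable {m : ℕ} {k : Type*} [Field k]

theorem units_eq_inv_iff (j : (ZMod m)ˣ) : j = j⁻¹ ↔ (j : ZMod m) ^ 2 = 1 := by
  rw [eq_inv_iff_mul_eq_one, Units.ext_iff, Units.val_mul, Units.val_one, sq]

/-- Equality of the linear parts means j = j⁻¹, after which the inverse has offset -jv. An even
translation leaves the offset v, giving v = -jv; in the odd case below the equation is j - v - 1 =
-jv. -/
theorem actG_affinePerm_dbl_eq_inv_iff (j : (ZMod m)ˣ) (v t : ZMod m) :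
    (matchedPairSn (2 * m)).actG (affinePerm j v) (transl (dbl m t)) = (affinePerm j v)⁻¹ ↔
      (j : ZMod m) ^ 2 = 1 ∧ v * (j + 1) = 0 := by
  rw [actG_affinePerm_dbl, affinePerm_inv, affinePerm_inj, units_eq_inv_iff]
  refine and_congr_right fun h => ?_
  rw [← (units_eq_inv_iff j).mpr h]
  constructor <;> intro h' <;> linear_combination h'

theorem actG_affinePerm_dbl_add_one_eq_inv_iff (j : (ZMod m)ˣ) (v t : ZMod m) :
    (matchedPairSn (2 * m)).actG (affinePerm j v) (transl (dbl m t + 1)) = (affinePerm j v)⁻¹ ↔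
      (j : ZMod m) ^ 2 = 1 ∧ (v + 1) * (j - 1) = 0 := by
  rw [actG_affinePerm_dbl_add_one, affinePerm_inv, affinePerm_inj, units_eq_inv_iff]
  refine and_congr_right fun h => ?_
  rw [← (units_eq_inv_iff j).mpr h]
  constructor <;> intro h' <;> linear_combination h'

variable [NeZero m]

/-- For y = `affinePerm j v` the product (y ▷ b)b is translation by 2t(j + 1) when b = 2t, and by
2(t(j + 1) + v + 1) when b = 2t + 1. The two summands collect these two parities. -/
theorem sum_indicatorTerm_affinePerm [Fintype (Cn (2 * m))] {x : Sn1 (2 * m)}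
    (hx : (matchedPairSn (2 * m)).stab x = evenTransl m) (φ : AddChar (ZMod m) k)
    (j : (ZMod m)ˣ) (v : ZMod m)
    (hv : ∃ b, (matchedPairSn (2 * m)).actG (affinePerm j v) b = x) :
    ∑ b, indicatorTerm x (evenChar hx φ) (affinePerm j v) b =
      (if (j : ZMod m) ^ 2 = 1 ∧ v * (j + 1) = 0 then ∑ t, φ (t * (j + 1)) else 0) +
      (if (j : ZMod m) ^ 2 = 1 ∧ (v + 1) * (j - 1) = 0 then
        (∑ t, φ (t * (j + 1))) * φ (v + 1) else 0) := by
  have hmem : ∀ t, transl (dbl m t) ∈ (matchedPairSn (2 * m)).stab x := fun t =>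
    hx ▸ transl_dbl_mem t
  rw [← Equiv.sum_comp ((parityEquiv m).trans (translEquiv (2 * m))), Fintype.sum_sum_type]
  congr 1
  · change ∑ t, indicatorTerm x (evenChar hx φ) (affinePerm j v) (transl (dbl m t)) = _
    split_ifs with h
    · refine Finset.sum_congr rfl fun t _ => ?_
      rw [indicatorTerm_of_eq _ ((actG_affinePerm_dbl_eq_inv_iff j v t).mpr h) hv _
        (hmem (t * (j + 1))), evenChar_apply]
      rw [actF_transl, transl_mul, affinePerm_dbl, ← map_add]
      congr 2
      ring
    · exact Finset.sum_eq_zero fun t _ => indicatorTerm_eq_zero_of_ne _ _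
        ((actG_affinePerm_dbl_eq_inv_iff j v t).not.mpr h)
  · change ∑ t, indicatorTerm x (evenChar hx φ) (affinePerm j v) (transl (dbl m t + 1)) = _
    split_ifs with h
    · rw [Finset.sum_mul]
      refine Finset.sum_congr rfl fun t _ => ?_
      rw [← AddChar.map_add_eq_mul,
        indicatorTerm_of_eq _ ((actG_affinePerm_dbl_add_one_eq_inv_iff j v t).mpr h) hv _
          (hmem (t * (j + 1) + (v + 1))), evenChar_apply]
      rw [actF_transl, transl_mul, affinePerm_dbl_add_one, add_add_add_comm, ← dbl_one,
        ← map_add, ← map_add]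
      congr 2
      ring
    · exact Finset.sum_eq_zero fun t _ => indicatorTerm_eq_zero_of_ne _ _
        ((actG_affinePerm_dbl_add_one_eq_inv_iff j v t).not.mpr h)

/-- The indicator of the module induced from the permutation `2t ↦ 2jt`, `2t + 1 ↦ 2(jt + u) + 1`
and the character `a^{2t} ↦ ψ (it)`. -/
def indicatorValue (j u i : ZMod m) : ℤ :=
  if j ^ 2 = 1 ∧ i * (j + 1) = 0 then
    if u * (j + 1) = 0 then 1
    else if (u + 1) * (j - 1) = 0 then if i * (u + 1) = 0 then 1 else -1
    else 0
  else 0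

/-- Only the two orbit points u and j - u - 1 contribute, and they contribute equally. Orthogonality
makes each sum over t equal to m or 0, so two such sums cancel |F| = 2m. -/
theorem hasIndicator_affinePerm [CharZero k] {ψ : AddChar (ZMod m) k} (hψ : ψ.IsPrimitive)
    {j : (ZMod m)ˣ} {u : ZMod m} (h : (j : ZMod m) ≠ 2 * u + 1) (i : ZMod m) (c : k) :
    HasIndicator (inducedRep (affinePerm j u)
      (evenChar ((stab_affinePerm_eq_iff j u).mpr h) (ψ.mulShift i))) c ↔
      (indicatorValue (j : ZMod m) u i : k) = c := by
  classical
  have : Fintype (Cn (2 * m)) := Fintype.ofFinite _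
  have hne : affinePerm j u ≠ affinePerm j (j - u - 1) := fun h' => h (by
    have h2 := ((affinePerm_inj).mp h').2
    linear_combination -h2)
  have horb : ∀ b, (matchedPairSn (2 * m)).actG (affinePerm j u) b = affinePerm j u ∨
      (matchedPairSn (2 * m)).actG (affinePerm j u) b = affinePerm j (j - u - 1) := fun b => by
    obtain ⟨s, rfl⟩ := exists_transl b
    rcases eq_dbl_or s with ⟨t, rfl⟩ | ⟨t, rfl⟩
    · exact Or.inl (actG_affinePerm_dbl j u t)
    · exact Or.inr (actG_affinePerm_dbl_add_one j u t)
  rw [hasIndicator_inducedRep_iff Cn_mul_comm,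
    Finset.sum_eq_add (affinePerm j u) (affinePerm j (j - u - 1)) hne ?_ (by simp) (by simp),
    sum_indicatorTerm_affinePerm, sum_indicatorTerm_affinePerm]
  rotate_left
  · exact ⟨transl (dbl m 0 + 1), by
      rw [actG_affinePerm_dbl_add_one]
      congr 1
      ring⟩
  · exact ⟨1, (matchedPairSn (2 * m)).actG_one _⟩
  · rintro y - ⟨hy1, hy2⟩
    refine Finset.sum_eq_zero fun b _ => ?_
    refine indicatorTerm_eq_zero_of_notMem _ _ b ?_
    rintro ⟨d, hd⟩
    have hy := (matchedPairSn (2 * m)).actG_mul_inv y d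
    rw [hd] at hy
    rcases horb d⁻¹ with h1 | h1
    · exact hy1 (hy.symm.trans h1)
    · exact hy2 (hy.symm.trans h1)
  have hcard : (Fintype.card (Cn (2 * m)) : k) = 2 * m := by
    rw [← Fintype.card_congr (translEquiv (2 * m)), ZMod.card]
    push_cast
    rfl
  have hm : (m : k) ≠ 0 := Nat.cast_ne_zero.mpr (NeZero.ne m)
  have hsum : ∑ t, (ψ.mulShift i) (t * ((j : ZMod m) + 1)) =
      if i * ((j : ZMod m) + 1) = 0 then (m : k) else 0 := by
    have h2 := AddChar.sum_mulShift (i * ((j : ZMod m) + 1)) hψ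
    rw [ZMod.card] at h2
    rw [Nat.cast_ite, Nat.cast_zero] at h2
    rw [← h2]
    refine Finset.sum_congr rfl fun t _ => ?_
    rw [AddChar.mulShift_apply]
    congr 1
    ring
  rw [hsum, hcard, Eq.congr_left]
  rw [indicatorValue]
  by_cases hj : (j : ZMod m) ^ 2 = 1
  swap
  · simp [hj]
  by_cases hi : i * ((j : ZMod m) + 1) = 0
  swap
  · simp [hi]
  -- When j² = 1 both offset conditions are invariant under u ↦ j - u - 1.
  have hA : ((j : ZMod m) - u - 1) * (j + 1) = 0 ↔ u * ((j : ZMod m) + 1) = 0 := by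
    constructor <;> intro h' <;> linear_combination -h' + hj
  have hB : ((j : ZMod m) - u - 1 + 1) * (j - 1) = 0 ↔ (u + 1) * ((j : ZMod m) - 1) = 0 := by
    constructor <;> intro h' <;> linear_combination -h' + hj
  simp only [hj, hi, hA, hB, true_and, if_true]
  by_cases hu : u * ((j : ZMod m) + 1) = 0
  · have hu' : ¬ (u + 1) * ((j : ZMod m) - 1) = 0 := fun h' => h (by
      linear_combination h' - hu)
    simp only [hu, hu', if_true, if_false, add_zero]
    field_simp
    ring
  by_cases hu' : (u + 1) * ((j : ZMod m) - 1) = 0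
  swap
  · simp [hu, hu']
  -- Thus ψ(i(u + 1)) squares to 1; by primitivity it equals 1 only when i(u + 1) = 0.
  have hw : i * (u + 1) + i * (u + 1) = 0 := by
    linear_combination (u + 1) * hi - i * hu'
  have hw' : i * ((j : ZMod m) - u - 1 + 1) = i * (u + 1) := by
    linear_combination hi - hw
  simp only [hu, hu', if_true, if_false, zero_add, AddChar.mulShift_apply, hw']
  have hsq : ψ (i * (u + 1)) * ψ (i * (u + 1)) = 1 := by
    rw [← AddChar.map_add_eq_mul, hw, AddChar.map_zero_eq_one]
  have hval : ψ (i * (u + 1)) = if i * (u + 1) = 0 then 1 else -1 := by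
    split_ifs with h0
    · rw [h0, AddChar.map_zero_eq_one]
    · exact (mul_self_eq_one_iff.mp hsq).resolve_left fun h1 =>
        h0 ((hψ.zmod_char_eq_one_iff m _).mp h1)
  rw [hval]
  push_cast
  field_simp
  ring

end Indicator

/-! ### The two-dimensional irreducible representations -/

section TwoDimensional

open Bismash

variable {m : ℕ} {k : Type*} [Field k]

/-- Every representation of dimension `d` can be realized on `k^d`. -/
theorem exists_irrep_equiv {A : Type*} [Ring A] [Algebra k A] {V : Type*} [AddCommGroup V]
    [Module k V] [FiniteDimensional k V] {ρ : A →ₐ[k] Module.End k V} (hρ : IsIrrep ρ) {d : ℕ}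
    (hd : Module.finrank k V = d) :
    ∃ (σ : Irrep k A d) (e : V ≃ₗ[k] (Fin d → k)), ∀ a v, e (ρ a v) = σ.1 a (e v) := by
  let e : V ≃ₗ[k] (Fin d → k) := LinearEquiv.ofFinrankEq V (Fin d → k) (by simp [hd])
  let σ : A →ₐ[k] Module.End k (Fin d → k) := (e.conjAlgEquiv k).toAlgHom.comp ρ
  have h : ∀ a v, e (ρ a v) = σ a (e v) := fun a v => by
    simp [σ, LinearEquiv.conjAlgEquiv]
  exact ⟨⟨σ, hρ.of_equiv e h⟩, e, h⟩

variable (m) in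
/-- The triples `(j, u, i)` that parametrize the pairs of a permutation with stabilizer `⟨a²⟩` and
a character of its stabilizer. -/
abbrev Param := {p : (ZMod m)ˣ × ZMod m // (p.1 : ZMod m) ≠ 2 * p.2 + 1} × ZMod m

/-- The permutation and the character with given parameters. -/
def Param.pair (ψ : AddChar (ZMod m) k) (q : Param m) :
    (x : Sn1 (2 * m)) × ((matchedPairSn (2 * m)).stab x →* kˣ) :=
  ⟨affinePerm q.1.1.1 q.1.1.2, evenChar ((stab_affinePerm_eq_iff _ _).mpr q.1.2) (ψ.mulShift q.2)⟩

/-- The parameters of the conjugate pair. -/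
def Param.swap (q : Param m) : Param m :=
  (⟨(q.1.1.1, q.1.1.1 - q.1.1.2 - 1), fun h => q.1.2 (by
    dsimp only at h
    linear_combination -h)⟩, q.2)

/-- A fixed point would satisfy u = j - u - 1, which is what the constraint on `Param` excludes;
isomorphism classes therefore have exactly two members. -/
theorem Param.swap_ne (q : Param m) : q ≠ q.swap := fun h => q.1.2 (by
  have h' : q.1.1.2 = q.1.1.1 - q.1.1.2 - 1 := congrArg (fun r : Param m => r.1.1.2) h
  linear_combination -h')

theorem Param.pair_injective [NeZero m] {ψ : AddChar (ZMod m) k} (hψ : ψ.IsPrimitive) :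
    Function.Injective (Param.pair ψ) := by
  rintro ⟨⟨⟨j, u⟩, h⟩, i⟩ ⟨⟨⟨j', u'⟩, h'⟩, i'⟩ heq
  obtain ⟨h1, h2⟩ := Sigma.mk.inj heq
  obtain ⟨rfl, rfl⟩ := affinePerm_inj.mp h1
  have h3 := AddChar.to_mulShift_inj_of_isPrimitive hψ
    (evenChar_injective _ (eq_of_heq h2))
  exact congrArg _ h3

theorem exists_param_pair_eq_iff [NeZero m] {ψ : AddChar (ZMod m) k}
    (hψ : Function.Surjective ψ.mulShift)
    (p : (x : Sn1 (2 * m)) × ((matchedPairSn (2 * m)).stab x →* kˣ)) :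
    (∃ q : Param m, q.pair ψ = p) ↔ Module.finrank k (Induced p.1 p.2) = 2 := by
  rw [finrank_induced, index_eq_two_iff_eq_evenTransl]
  constructor
  · rintro ⟨⟨⟨⟨j, u⟩, h⟩, i⟩, rfl⟩
    exact (stab_affinePerm_eq_iff j u).mpr h
  · obtain ⟨x, χ⟩ := p
    intro hx
    change (matchedPairSn (2 * m)).stab x = evenTransl m at hx
    obtain ⟨j, u, rfl⟩ := exists_affinePerm hx
    obtain ⟨φ, rfl⟩ := evenChar_surjective hx χ
    obtain ⟨i, rfl⟩ := hψ φ
    exact ⟨(⟨(j, u), (stab_affinePerm_eq_iff j u).mp hx⟩, i), rfl⟩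

theorem exists_equiv_param_iff [NeZero m] {ψ : AddChar (ZMod m) k} (hψ : ψ.IsPrimitive)
    (q r : Param m) :
    (∃ e : Induced (q.pair ψ).1 (q.pair ψ).2 ≃ₗ[k] Induced (r.pair ψ).1 (r.pair ψ).2,
      ∀ u w, e (inducedRep (q.pair ψ).1 (q.pair ψ).2 u w) =
        inducedRep (r.pair ψ).1 (r.pair ψ).2 u (e w)) ↔ r = q ∨ r = q.swap := by
  rw [exists_equiv_induced_iff Cn_mul_comm]
  obtain ⟨⟨⟨j, u⟩, h⟩, i⟩ := q
  obtain ⟨⟨⟨j', u'⟩, h'⟩, i'⟩ := r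
  change (∃ b, (matchedPairSn (2 * m)).actG (affinePerm j u) b = affinePerm j' u') ∧
    (∀ c (h1 : c ∈ (matchedPairSn (2 * m)).stab (affinePerm j u))
      (h2 : c ∈ (matchedPairSn (2 * m)).stab (affinePerm j' u')),
      evenChar ((stab_affinePerm_eq_iff j u).mpr h) (ψ.mulShift i) ⟨c, h1⟩ =
        evenChar ((stab_affinePerm_eq_iff j' u').mpr h') (ψ.mulShift i') ⟨c, h2⟩) ↔ _
  have h1 : (∃ b, (matchedPairSn (2 * m)).actG (affinePerm j u) b = affinePerm j' u') ↔
      (j' = j ∧ u' = u) ∨ (j' = j ∧ u' = j - u - 1) := by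
    constructor
    · rintro ⟨b, hb⟩
      obtain ⟨s, rfl⟩ := exists_transl b
      rcases eq_dbl_or s with ⟨t, rfl⟩ | ⟨t, rfl⟩
      · rw [actG_affinePerm_dbl] at hb
        exact Or.inl (affinePerm_inj.mp hb.symm)
      · rw [actG_affinePerm_dbl_add_one] at hb
        exact Or.inr (affinePerm_inj.mp hb.symm)
    · rintro (⟨rfl, rfl⟩ | ⟨rfl, rfl⟩)
      · exact ⟨1, (matchedPairSn (2 * m)).actG_one _⟩
      · exact ⟨_, actG_affinePerm_dbl_add_one j' u 0⟩
  have h2 : (∀ c (h1 : c ∈ (matchedPairSn (2 * m)).stab (affinePerm j u))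
      (h2 : c ∈ (matchedPairSn (2 * m)).stab (affinePerm j' u')),
      evenChar ((stab_affinePerm_eq_iff j u).mpr h) (ψ.mulShift i) ⟨c, h1⟩ =
        evenChar ((stab_affinePerm_eq_iff j' u').mpr h') (ψ.mulShift i') ⟨c, h2⟩) ↔ i' = i := by
    constructor
    · intro hall
      refine AddChar.to_mulShift_inj_of_isPrimitive hψ (DFunLike.ext _ _ fun t => ?_)
      have h3 := congrArg Units.val (hall (transl (dbl m t))
        (evenTransl_le_stab _ _ (transl_dbl_mem t)) (evenTransl_le_stab _ _ (transl_dbl_mem t)))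
      rw [evenChar_apply, evenChar_apply] at h3
      exact h3.symm
    · rintro rfl c h1 h2
      have hc := h1
      rw [(stab_affinePerm_eq_iff j u).mpr h] at hc
      obtain ⟨t, rfl⟩ := hc
      exact Units.ext (by rw [evenChar_apply, evenChar_apply])
  rw [h1, h2]
  simp only [Param.swap, Prod.mk.injEq, Subtype.mk.injEq, or_and_right]

theorem indicatorValue_mem (j u i : ZMod m) :
    indicatorValue j u i = 1 ∨ indicatorValue j u i = -1 ∨ indicatorValue j u i = 0 := by
  unfold indicatorValue
  split_ifs <;> simp

variable [NeZero m] [CharZero k]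

theorem setOf_induced_eq_image {ψ : AddChar (ZMod m) k} (hψ : ψ.IsPrimitive)
    (hψ' : Function.Surjective ψ.mulShift) (c : k) :
    {p : (x : Sn1 (2 * m)) × ((matchedPairSn (2 * m)).stab x →* kˣ) |
      IsIrrep (inducedRep p.1 p.2) ∧ Module.finrank k (Induced p.1 p.2) = 2 ∧
        HasIndicator (inducedRep p.1 p.2) c} =
      Param.pair ψ '' {q | (indicatorValue (q.1.1.1 : ZMod m) q.1.1.2 q.2 : k) = c} := by
  ext p
  constructor
  · rintro ⟨-, h1, h2⟩
    obtain ⟨q, rfl⟩ := (exists_param_pair_eq_iff hψ' p).mpr h1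
    exact ⟨q, (hasIndicator_affinePerm hψ q.1.2 q.2 c).mp h2, rfl⟩
  · rintro ⟨q, hq, rfl⟩
    exact ⟨isIrrep_inducedRep _ _, (exists_param_pair_eq_iff hψ' _).mp ⟨q, rfl⟩,
      (hasIndicator_affinePerm hψ q.1.2 q.2 c).mpr hq⟩

open Classical in
theorem numInduced_eq_card [IsAlgClosed k] (c : k) :
    numInduced k (matchedPairSn (2 * m)) 2 c = (Finset.univ.filter fun q : Param m =>
      (indicatorValue (q.1.1.1 : ZMod m) q.1.1.2 q.2 : k) = c).card := by
  obtain ⟨ψ, hψ, hψ'⟩ := exists_isPrimitive_addChar (m := m) (k := k)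
  rw [numInduced, setOf_induced_eq_image hψ hψ', Set.ncard_image_of_injective _
    (Param.pair_injective hψ), ← Set.ncard_coe_finset]
  simp

/-- This hides the choice of ψ and of realizations on k², leaving only what the count needs. The
indicator clause covers every representative of a class, so no separate well-definedness argument is
required. -/
theorem exists_classMap [IsAlgClosed k] : ∃ f : Param m → IrrepClass k (Jn k (2 * m)) 2,
    Function.Surjective f ∧ (∀ q r, f q = f r ↔ r = q ∨ r = q.swap) ∧
    ∀ (q : Param m) (ρ : Irrep k (Jn k (2 * m)) 2) (c : k), Quotient.mk _ ρ = f q →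
      (HasIndicator ρ.1 c ↔ (indicatorValue (q.1.1.1 : ZMod m) q.1.1.2 q.2 : k) = c) := by
  obtain ⟨ψ, hψ, hψ'⟩ := exists_isPrimitive_addChar (m := m) (k := k)
  have hfin : ∀ q : Param m, Module.finrank k (Induced (q.pair ψ).1 (q.pair ψ).2) = 2 :=
    fun q => (exists_param_pair_eq_iff hψ' _).mp ⟨q, rfl⟩
  choose σ e he using fun q : Param m => by
    have : FiniteDimensional k (Induced (q.pair ψ).1 (q.pair ψ).2) :=
      FiniteDimensional.of_finrank_pos (by rw [hfin]; norm_num)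
    exact exists_irrep_equiv (isIrrep_inducedRep (q.pair ψ).1 (q.pair ψ).2) (hfin q)
  have he' : ∀ q a v, (e q).symm ((σ q).1 a v) =
      inducedRep (q.pair ψ).1 (q.pair ψ).2 a ((e q).symm v) := fun q a v => by
    rw [LinearEquiv.symm_apply_eq, he, LinearEquiv.apply_symm_apply]
  refine ⟨fun q => Quotient.mk _ (σ q), ?_, fun q r => ?_, fun q ρ c hρ => ?_⟩
  · intro C
    induction C using Quotient.inductionOn with | h ρ => ?_
    obtain ⟨x, χ, g, hg⟩ := exists_induced_equiv ρ.2
    have h2 : Module.finrank k (Induced x χ) = 2 := by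
      rw [g.finrank_eq]
      simp
    obtain ⟨q, hq⟩ := (exists_param_pair_eq_iff hψ' ⟨x, χ⟩).mpr h2
    -- The isomorphism is restated existentially so that `hq` rewrites the space and the action
    -- together.
    have hx : ∃ g : Induced (q.pair ψ).1 (q.pair ψ).2 ≃ₗ[k] (Fin 2 → k), ∀ u w,
        g (inducedRep (q.pair ψ).1 (q.pair ψ).2 u w) = ρ.1 u (g w) := by
      rw [hq]
      exact ⟨g, hg⟩
    obtain ⟨g', hg'⟩ := hx
    refine ⟨q, Quotient.sound ⟨(e q).symm.trans g', fun a v => ?_⟩⟩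
    rw [LinearEquiv.trans_apply, LinearEquiv.trans_apply, he', hg']
  · rw [← exists_equiv_param_iff hψ, Quotient.eq]
    constructor
    · rintro ⟨g, hg⟩
      exact ⟨((e q).trans g).trans (e r).symm, fun a v => by simp [he, hg, he']⟩
    · rintro ⟨g, hg⟩
      exact ⟨((e q).symm.trans g).trans (e r), fun a v => by simp [he, hg, he']⟩
  · obtain ⟨g, hg⟩ := Quotient.exact hρ
    rw [← hasIndicator_affinePerm hψ q.1.2 q.2 c]
    constructor
    · intro h
      exact (h.of_equiv g hg).of_equiv (e q).symm (he' q)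
    · intro h
      have h1 : HasIndicator (σ q).1 c := HasIndicator.of_equiv (e q) (he q) h
      exact h1.of_equiv g.symm fun a v => by
        rw [LinearEquiv.symm_apply_eq, hg, LinearEquiv.apply_symm_apply]

theorem finite_irrepClass [IsAlgClosed k] : Finite (IrrepClass k (Jn k (2 * m)) 2) := by
  obtain ⟨f, hf, -⟩ := exists_classMap (m := m) (k := k)
  exact Finite.of_surjective f hf

/-- Every fibre of the class map is a pair {q, q.swap}, on which the indicator is constant. -/
theorem two_mul_numIrrepClasses [IsAlgClosed k] (c : k) :
    2 * numIrrepClasses k (Jn k (2 * m)) 2 c = numInduced k (matchedPairSn (2 * m)) 2 c := by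
  classical
  obtain ⟨f, hf, hfib, hind⟩ := exists_classMap (m := m) (k := k)
  have : Finite (IrrepClass k (Jn k (2 * m)) 2) := Finite.of_surjective f hf
  have : Fintype (IrrepClass k (Jn k (2 * m)) 2) := Fintype.ofFinite _
  have hmem : ∀ q, (∃ ρ : Irrep k (Jn k (2 * m)) 2, Quotient.mk _ ρ = f q ∧ HasIndicator ρ.1 c) ↔
      (indicatorValue (q.1.1.1 : ZMod m) q.1.1.2 q.2 : k) = c := fun q => by
    constructor
    · rintro ⟨ρ, hρ, h⟩
      exact (hind q ρ c hρ).mp h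
    · intro h
      obtain ⟨ρ, hρ⟩ := Quotient.exists_rep (f q)
      exact ⟨ρ, hρ, (hind q ρ c hρ).mpr h⟩
  rw [numInduced_eq_card, numIrrepClasses, Set.ncard_eq_toFinset_card',
    Finset.card_eq_sum_card_fiberwise (f := f) (t := Set.toFinset {C : IrrepClass k _ 2 |
      ∃ ρ : Irrep k (Jn k (2 * m)) 2, Quotient.mk _ ρ = C ∧ HasIndicator ρ.1 c}),
    Finset.sum_congr rfl (g := fun _ => 2), Finset.sum_const, smul_eq_mul, mul_comm]
  · intro C hC
    obtain ⟨q, rfl⟩ := hf C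
    have hq := (hmem q).mp (by simpa using hC)
    have hsw : f q = f q.swap := (hfib q q.swap).mpr (Or.inr rfl)
    have hq' : (indicatorValue (q.swap.1.1.1 : ZMod m) q.swap.1.1.2 q.swap.2 : k) = c := by
      rw [← hmem, ← hsw, hmem]
      exact hq
    refine Eq.trans (congrArg Finset.card ?_) (Finset.card_pair q.swap_ne)
    ext r
    simp only [Finset.mem_filter, Finset.mem_univ, true_and, Finset.mem_insert,
      Finset.mem_singleton, ← hfib]
    constructor
    · rintro ⟨-, h⟩
      exact h.symm
    · intro h
      refine ⟨?_, h.symm⟩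
      rcases (hfib q r).mp h with rfl | rfl
      · exact hq
      · exact hq'
  · intro q hq
    have hq' : (indicatorValue (q.1.1.1 : ZMod m) q.1.1.2 q.2 : k) = c := by simpa using hq
    simpa using (hmem q).mpr hq'

theorem hasIndicator_irrep [IsAlgClosed k] (ρ : Irrep k (Jn k (2 * m)) 2) :
    HasIndicator ρ.1 1 ∨ HasIndicator ρ.1 (-1) ∨ HasIndicator ρ.1 0 := by
  obtain ⟨f, hf, -, hind⟩ := exists_classMap (m := m) (k := k)
  obtain ⟨q, hq⟩ := hf (Quotient.mk _ ρ)
  rw [hind q ρ _ hq.symm, hind q ρ _ hq.symm, hind q ρ _ hq.symm]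
  rcases indicatorValue_mem (q.1.1.1 : ZMod m) q.1.1.2 q.2 with h | h | h <;> simp [h]

theorem ncard_stabSet : (stabSet (2 * m) 2).ncard =
    Nat.card {p : (ZMod m)ˣ × ZMod m // (p.1 : ZMod m) ≠ 2 * p.2 + 1} := by
  have h : stabSet (2 * m) 2 = (fun p : (ZMod m)ˣ × ZMod m => affinePerm p.1 p.2) ''
      {p | (p.1 : ZMod m) ≠ 2 * p.2 + 1} := by
    ext x
    rw [stabSet, Set.mem_ofPred_eq, zpowers_cycleA_sq]
    constructor
    · intro hx
      obtain ⟨j, u, rfl⟩ := exists_affinePerm hx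
      exact ⟨(j, u), (stab_affinePerm_eq_iff j u).mp hx, rfl⟩
    · rintro ⟨⟨j, u⟩, h, rfl⟩
      exact (stab_affinePerm_eq_iff j u).mpr h
  rw [h, Set.ncard_image_of_injective _ fun p q h => Prod.ext (affinePerm_inj.mp h).1
    (affinePerm_inj.mp h).2]
  rfl

end TwoDimensional

/-! ### Counting -/

section Counting

open Bismash

variable {m : ℕ}

theorem deltaBar_eq (u j : ℕ) :
    deltaBar u j m = if (j : ZMod m) = 2 * (u : ZMod m) + 1 then 0 else 1 := by
  simp only [deltaBar, ← ZMod.natCast_eq_natCast_iff]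
  push_cast
  rfl

theorem deltaZero_eq (i u : ℕ) :
    deltaZero i u m = if (i : ZMod m) * ((u : ZMod m) + 1) = 0 then 1 else 0 := by
  simp only [deltaZero, ← ZMod.intCast_eq_intCast_iff]
  push_cast
  simp only [neg_mul, neg_eq_zero]

theorem deltaNonzero_eq (i u : ℕ) :
    deltaNonzero i u m = if (i : ZMod m) * ((u : ZMod m) + 1) = 0 then 0 else 1 := by
  simp only [deltaNonzero, ← ZMod.intCast_eq_intCast_iff]
  push_cast
  simp only [neg_mul, neg_eq_zero]

variable [NeZero m]

theorem sum_Icc_natCast (g : ZMod m → ℕ) : ∑ a ∈ Finset.Icc 1 m, g a = ∑ a, g a := by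
  refine Finset.sum_bij (fun a _ => (a : ZMod m)) (fun a _ => Finset.mem_univ _)
    (fun a ha b hb h => ?_) (fun c _ => ?_) fun a _ => rfl
  · rw [Finset.mem_Icc] at ha hb
    rw [ZMod.natCast_eq_natCast_iff] at h
    have h1 : a - 1 ≡ b - 1 [MOD m] := Nat.ModEq.add_right_cancel' 1 (by
      rwa [Nat.sub_add_cancel ha.1, Nat.sub_add_cancel hb.1])
    have h2 := h1.eq_of_lt_of_lt (by omega) (by omega)
    omega
  · have hm := NeZero.pos m
    -- The range starts at 1, so the residue 0 is represented by m.
    by_cases h0 : c.val = 0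
    · refine ⟨m, Finset.mem_Icc.mpr ⟨hm, le_rfl⟩, ?_⟩
      rw [ZMod.natCast_self, (ZMod.val_eq_zero c).mp h0]
    · exact ⟨c.val, Finset.mem_Icc.mpr ⟨by omega, c.val_lt.le⟩, ZMod.natCast_zmod_val c⟩

theorem sum_filter_Icc_natCast (p : ℕ → Prop) [DecidablePred p] (P : ZMod m → Prop)
    [DecidablePred P] (hp : ∀ a : ℕ, p a ↔ P a) (f : ℕ → ℕ) (g : ZMod m → ℕ)
    (hf : ∀ a : ℕ, f a = g a) :
    ∑ a ∈ (Finset.Icc 1 m).filter p, f a = ∑ a, if P a then g a else 0 := by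
  rw [Finset.sum_filter, ← sum_Icc_natCast]
  exact Finset.sum_congr rfl fun a _ => by simp only [hp, hf]

theorem sum_setE (f : ℕ → ℕ) (g : ZMod m → ℕ) (hf : ∀ a : ℕ, f a = g a) :
    ∑ j ∈ setE m, f j = ∑ j : ZMod m, if j ^ 2 = 1 then g j else 0 :=
  sum_filter_Icc_natCast _ _ (fun a => by
    rw [← ZMod.natCast_eq_natCast_iff]
    push_cast
    rfl) f g hf

theorem sum_setK (j : ℕ) (f : ℕ → ℕ) (g : ZMod m → ℕ) (hf : ∀ a : ℕ, f a = g a) :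
    ∑ u ∈ setK j m, f u = ∑ u : ZMod m, if u * ((j : ZMod m) + 1) = 0 then g u else 0 :=
  sum_filter_Icc_natCast _ _ (fun a => by
    rw [← ZMod.natCast_eq_natCast_iff]
    push_cast
    rfl) f g hf

theorem sum_setK' (j : ℕ) (f : ℕ → ℕ) (g : ZMod m → ℕ) (hf : ∀ a : ℕ, f a = g a) :
    ∑ u ∈ setK' j m, f u =
      ∑ u : ZMod m, if (u + 1) * ((j : ZMod m) - 1) = 0 then g u else 0 :=
  sum_filter_Icc_natCast _ _ (fun a => by
    rw [← ZMod.intCast_eq_intCast_iff]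
    push_cast
    rfl) f g hf

/-- Multiplication by j + 1 on a cyclic group of order m has a kernel of order gcd(j + 1, m). -/
theorem alpha_eq (j : ℕ) :
    alpha j m = ∑ i : ZMod m, if i * ((j : ZMod m) + 1) = 0 then 1 else 0 := by
  have h := IsAddCyclic.card_nsmulAddMonoidHom_ker (G := ZMod m) (j + 1)
  rw [Nat.card_zmod, Nat.gcd_comm] at h
  rw [alpha, ← h, Nat.card_eq_fintype_card, Fintype.card_subtype, Finset.card_filter]
  refine Finset.sum_congr rfl fun i _ => ?_
  congr 1
  simp [AddMonoidHom.mem_ker, mul_comm]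

/-- Parameters have j a unit, whereas the formulas sum over residues. Any residue with j² = 1 is its
own inverse, so non-units contribute nothing. -/
theorem card_filter_param (P : ZMod m → ZMod m → ZMod m → Prop) [∀ j u i, Decidable (P j u i)]
    (hP : ∀ j u i, P j u i → j ^ 2 = 1) :
    (Finset.univ.filter fun q : Param m => P q.1.1.1 q.1.1.2 q.2).card =
      ∑ j : ZMod m, ∑ u, ∑ i, if j ≠ 2 * u + 1 ∧ P j u i then 1 else 0 := by
  have h : (Finset.univ.filter fun q : Param m => P q.1.1.1 q.1.1.2 q.2).card =
      (Finset.univ.filter fun q : (ZMod m)ˣ × ZMod m × ZMod m =>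
        (q.1 : ZMod m) ≠ 2 * q.2.1 + 1 ∧ P q.1 q.2.1 q.2.2).card := by
    refine Finset.card_bij (fun q _ => (q.1.1.1, q.1.1.2, q.2)) ?_ ?_ ?_
    · rintro ⟨⟨⟨j, u⟩, h⟩, i⟩ hq
      simpa [h] using hq
    · rintro ⟨⟨⟨j, u⟩, h⟩, i⟩ _ ⟨⟨⟨j', u'⟩, h'⟩, i'⟩ _ heq
      simp only [Prod.mk.injEq] at heq
      obtain ⟨rfl, rfl, rfl⟩ := heq
      rfl
    · rintro ⟨j, u, i⟩ hq
      simp only [Finset.mem_filter, Finset.mem_univ, true_and] at hq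
      exact ⟨(⟨(j, u), hq.1⟩, i), by simpa using hq.2, rfl⟩
  rw [h, Finset.card_filter, Fintype.sum_prod_type]
  simp only [Fintype.sum_prod_type]
  refine Fintype.sum_of_injective (fun j : (ZMod m)ˣ => (j : ZMod m)) Units.val_injective _ _
    (fun j hj => ?_) fun j => rfl
  refine Finset.sum_eq_zero fun u _ => Finset.sum_eq_zero fun i _ => if_neg fun h => hj ?_
  have h2 := hP j u i h.2
  exact ⟨⟨j, j, by rw [← sq, h2], by rw [← sq, h2]⟩, rfl⟩

theorem card_indicatorValue_eq_one :
    (Finset.univ.filter fun q : Param m =>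
      indicatorValue (q.1.1.1 : ZMod m) q.1.1.2 q.2 = 1).card =
    (∑ j ∈ setE m, ∑ u ∈ setK j m, deltaBar u j m * alpha j m) +
      ∑ j ∈ setE m, ∑ u ∈ setK' j m, ∑ i ∈ setK j m, deltaBar u j m * deltaZero i u m := by
  rw [card_filter_param (fun j u i => indicatorValue j u i = 1) fun j u i h => by
      by_contra hj
      simp [indicatorValue, hj] at h,
    sum_setE _ (fun j => ∑ u, if u * (j + 1) = 0 then (if j = 2 * u + 1 then 0 else 1) *
      ∑ i, (if i * (j + 1) = 0 then 1 else 0) else 0) fun j =>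
        sum_setK j _ _ fun u => by rw [deltaBar_eq, alpha_eq],
    sum_setE _ (fun j => ∑ u, if (u + 1) * (j - 1) = 0 then (∑ i, if i * (j + 1) = 0 then
      (if j = 2 * u + 1 then 0 else 1) * (if i * (u + 1) = 0 then 1 else 0) else 0) else 0) fun j =>
        sum_setK' j _ _ fun u => sum_setK j _ _ fun i => by rw [deltaBar_eq, deltaZero_eq],
    ← Finset.sum_add_distrib]
  refine Finset.sum_congr rfl fun j _ => ?_
  by_cases hj : j ^ 2 = 1
  swap
  · simp [hj, indicatorValue]
  rw [if_pos hj, if_pos hj, ← Finset.sum_add_distrib]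
  refine Finset.sum_congr rfl fun u _ => ?_
  by_cases hu : j = 2 * u + 1
  · simp [← hu]
  simp only [hj, hu, indicatorValue, true_and, ne_eq, not_false_eq_true, if_false, one_mul]
  by_cases h1 : u * (j + 1) = 0
  · have h2 : ¬ (u + 1) * (j - 1) = 0 := fun h' => hu (by linear_combination h' - h1)
    simp [h1, h2]
  · by_cases h2 : (u + 1) * (j - 1) = 0
    · simp only [h1, h2, if_true, if_false, zero_add]
      refine Finset.sum_congr rfl fun i _ => ?_
      split_ifs <;> simp_all
    · simp [h1, h2]

theorem card_indicatorValue_eq_neg_one :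
    (Finset.univ.filter fun q : Param m =>
      indicatorValue (q.1.1.1 : ZMod m) q.1.1.2 q.2 = -1).card =
      ∑ j ∈ setE m, ∑ u ∈ setK' j m, ∑ i ∈ setK j m, deltaBar u j m * deltaNonzero i u m := by
  rw [card_filter_param (fun j u i => indicatorValue j u i = -1) fun j u i h => by
      by_contra hj
      simp [indicatorValue, hj] at h,
    sum_setE _ (fun j => ∑ u, if (u + 1) * (j - 1) = 0 then (∑ i, if i * (j + 1) = 0 then
      (if j = 2 * u + 1 then 0 else 1) * (if i * (u + 1) = 0 then 0 else 1) else 0) else 0) fun j =>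
        sum_setK' j _ _ fun u => sum_setK j _ _ fun i => by rw [deltaBar_eq, deltaNonzero_eq]]
  refine Finset.sum_congr rfl fun j _ => ?_
  by_cases hj : j ^ 2 = 1
  swap
  · simp [hj, indicatorValue]
  rw [if_pos hj]
  refine Finset.sum_congr rfl fun u _ => ?_
  by_cases hu : j = 2 * u + 1
  · simp [← hu]
  simp only [hj, hu, indicatorValue, true_and, ne_eq, not_false_eq_true, if_false, one_mul]
  by_cases h1 : u * (j + 1) = 0
  · have h2 : ¬ (u + 1) * (j - 1) = 0 := fun h' => hu (by linear_combination h' - h1)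
    simp only [h1, h2, if_true, if_false]
    refine Finset.sum_eq_zero fun i _ => ?_
    split_ifs <;> simp_all
  · by_cases h2 : (u + 1) * (j - 1) = 0
    · simp only [h1, h2, if_true, if_false]
      refine Finset.sum_congr rfl fun i _ => ?_
      split_ifs <;> simp_all
    · simp [h1, h2]

/-- Each permutation with stabilizer ⟨a²⟩ carries m characters, and the indicator takes only three
values. -/
theorem card_indicatorValue_add :
    (Finset.univ.filter fun q : Param m =>
      indicatorValue (q.1.1.1 : ZMod m) q.1.1.2 q.2 = 0).card +
    (Finset.univ.filter fun q : Param m =>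
      indicatorValue (q.1.1.1 : ZMod m) q.1.1.2 q.2 = 1).card +
    (Finset.univ.filter fun q : Param m =>
      indicatorValue (q.1.1.1 : ZMod m) q.1.1.2 q.2 = -1).card =
    m * (stabSet (2 * m) 2).ncard := by
  have h : m * (stabSet (2 * m) 2).ncard = Fintype.card (Param m) := by
    rw [ncard_stabSet, Nat.card_eq_fintype_card, Fintype.card_prod, ZMod.card, mul_comm]
  rw [h, ← Finset.card_univ, Finset.card_filter, Finset.card_filter, Finset.card_filter,
    ← Finset.sum_add_distrib, ← Finset.sum_add_distrib, Finset.card_eq_sum_ones]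
  refine Finset.sum_congr rfl fun q _ => ?_
  rcases indicatorValue_mem (q.1.1.1 : ZMod m) q.1.1.2 q.2 with h | h | h <;> simp [h]

theorem numInduced_intCast_eq_card {k : Type*} [Field k] [IsAlgClosed k] [CharZero k] (c : ℤ) :
    numInduced k (matchedPairSn (2 * m)) 2 (c : k) = (Finset.univ.filter fun q : Param m =>
      indicatorValue (q.1.1.1 : ZMod m) q.1.1.2 q.2 = c).card := by
  classical
  rw [numInduced_eq_card]
  simp only [Int.cast_inj]

end Counting

end

/-! ### The counting theorem for n = 2m -/

theorem mainTheorem4 {k : Type*} [Field k] [IsAlgClosed k] [CharZero k]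
    (n : ℕ) [NeZero n] (hn : Even n) :
    -- counted once for each permutation `x` from which they are induced
    Bismash.numInduced k (matchedPairSn n) 2 1 =
        (∑ j ∈ setE (n / 2), ∑ u ∈ setK j (n / 2), deltaBar u j (n / 2) * alpha j (n / 2)) +
        (∑ j ∈ setE (n / 2), ∑ u ∈ setK' j (n / 2), ∑ i ∈ setK j (n / 2),
          deltaBar u j (n / 2) * deltaZero i u (n / 2)) ∧
    Bismash.numInduced k (matchedPairSn n) 2 (-1) =
        ∑ j ∈ setE (n / 2), ∑ u ∈ setK' j (n / 2), ∑ i ∈ setK j (n / 2),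
          deltaBar u j (n / 2) * deltaNonzero i u (n / 2) ∧
    (Bismash.numInduced k (matchedPairSn n) 2 0 : ℤ) =
        ((n / 2 : ℕ) : ℤ) * ((stabSet n 2).ncard : ℤ) -
          (Bismash.numInduced k (matchedPairSn n) 2 1 : ℤ) -
          (Bismash.numInduced k (matchedPairSn n) 2 (-1) : ℤ) ∧
    -- up to isomorphism
    Finite (IrrepClass k (Jn k n) 2) ∧
    (∀ c : k, 2 * numIrrepClasses k (Jn k n) 2 c =
        Bismash.numInduced k (matchedPairSn n) 2 c) ∧
    (∀ ρ : Irrep k (Jn k n) 2,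
        HasIndicator ρ.1 1 ∨ HasIndicator ρ.1 (-1) ∨ HasIndicator ρ.1 0) := by

  obtain ⟨m, rfl⟩ := even_iff_two_dvd.mp hn
  have : NeZero m := ⟨fun h => NeZero.ne (2 * m) (by rw [h, mul_zero])⟩
  rw [Nat.mul_div_cancel_left m two_pos]
  have h1 := numInduced_intCast_eq_card (m := m) (k := k) 1
  have h2 := numInduced_intCast_eq_card (m := m) (k := k) (-1)
  have h0 := numInduced_intCast_eq_card (m := m) (k := k) 0
  push_cast at h0 h1 h2
  refine ⟨?_, ?_, ?_, finite_irrepClass, two_mul_numIrrepClasses, hasIndicator_irrep⟩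
  · rw [h1, card_indicatorValue_eq_one]
  · rw [h2, card_indicatorValue_eq_neg_one]
  · rw [h0, h1, h2, ← Nat.cast_mul, ← card_indicatorValue_add]
    push_cast
    ring
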